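/- Consider homogeneous linear (Toupin--Mindlin) first strain-gradient elastic solids in three dimensions. With strain $e_{lm}=\frac12(u_{l,m}+u_{m,l})$, the stress and hyper-stress of a displacement field $u$ are $$\sigma_{ik}=C_{iklm}e_{lm}+M_{iklmn}e_{lm,n},\qquad \tau_{ijk}=M_{lmijk}e_{lm}+A_{ijklmn}e_{lm,n},$$ where $C,M,A$ are constant tensors with the index symmetries $C_{ijlm}=C_{jilm}=C_{lmij}$, $M_{ijklm}=M_{jiklm}=M_{ijlkm}$, $A_{ijklmn}=A_{jiklmn}=A_{lmnijk}$. Equilibrium without body forces reads $\sigma_{ik,i}-\tau_{ijk,ij}=0$. The materials of the tetragonal class $\mathbb Z_4\oplus\mathbb Z_2^c$ are all triples $(C,M,A)$ that are invariant under the group generated by the rotation by $\pi/2$ about the $x_3$-axis and the inversion $-I$, with $C$ in the classical tetragonal form, i.e. invariant in addition under the rotation by $\pi$ about the $x_1$-axis (Hermann--Mauguin symbol $4/mmm$, six independent constants). Let $\Omega\subseteq\mathbb R^3$ be open and connected. A $C^4$ displacement field on $\Omega$ is called universal for the class if it is in equilibrium without body forces for every material of the class. Then: (a) $M=0$ for every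 material of the class. (b) A field $u$ on $\Omega$ is universal if and only if it is the superposition of a homogeneous displacement field $b+Fx$ (with $b\in\mathbb R^3$, $F\in\mathbb R^{3\times3}$ constant) and a field $$(c_1x_2x_3+c_2x_1x_3,\;-c_2x_2x_3+c_3x_1x_3,\;g(x_1,x_2)),$$ where $c_1,c_2,c_3$ are real constants and $g:\mathbb R^2\to\mathbb R$ is a harmonic function of class $C^4$ that satisfies the fourth-order constraints $$\frac{\partial^4 g}{\partial x_1^2\partial x_2^2}=\frac{\partial^4 g}{\partial x_1^4}+\frac{\partial^4 g}{\partial x_2^4}=\frac{\partial^4 g}{\partial x_1^3\partial x_2}=\frac{\partial^4 g}{\partial x_1\partial x_2^3}=0.$$ (c) A function $g:\mathbb R^2\to\mathbb R$ is of class $C^4$ and satisfies these constraints if and only if $$g(x_1,x_2)=f_1(x_1)+x_2f_2(x_1)+f_3(x_2)+x_1f_4(x_2)$$ for some $C^4$ functions $f_1,\dots,f_4:\mathbb R\to\mathbb R$ with $f_2'''=f_4'''=0$ and $f_3''''=-f_1''''=c$ for a real constant $c$. Hence the universal displacement fields are exactly the superpositions in (b) with $g$ harmonic and of this form. The last characterization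 holds equally if the equilibrium equation is written as $\sigma_{ik,i}-\tau_{ikj,ij}=0$, the Euler--Lagrange equation of the energy density $\frac12C_{iklm}e_{ik}e_{lm}+M_{iklmn}e_{ik}e_{lm,n}+\frac12A_{ijklmn}e_{ij,k}e_{lm,n}$. -/

import Mathlib

noncomputable section

namespace StrainGradient

/-- Points of, and vectors in, Euclidean `n`-space. -/
abbrev E (n : ℕ) : Type := EuclideanSpace ℝ (Fin n)

/-- The partial derivative `∂f/∂xᵢ` of a scalar function (coordinates are numbered from `0`). -/
def pd {n : ℕ} (i : Fin n) (f : E n → ℝ) : E n → ℝ :=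
  fun x => fderiv ℝ f x (EuclideanSpace.single i 1)

/-- The elastic moduli of a homogeneous linear first strain-gradient solid: the tensors `C`, `M`
and `A` of orders four, five and six in the energy density
`½ C_{iklm} e_{ik} e_{lm} + M_{iklmn} e_{ik} e_{lm,n} + ½ A_{ijklmn} e_{ij,k} e_{lm,n}`,
with their index symmetries. -/
structure Moduli where
  C : Fin 3 → Fin 3 → Fin 3 → Fin 3 → ℝ
  M : Fin 3 → Fin 3 → Fin 3 → Fin 3 → Fin 3 → ℝ
  A : Fin 3 → Fin 3 → Fin 3 → Fin 3 → Fin 3 → Fin 3 → ℝ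
  C_minor : ∀ i j l m, C i j l m = C j i l m
  C_major : ∀ i j l m, C i j l m = C l m i j
  M_left : ∀ i j k l m, M i j k l m = M j i k l m
  M_right : ∀ i j k l m, M i j k l m = M i j l k m
  A_minor : ∀ i j k l m n, A i j k l m n = A j i k l m n
  A_major : ∀ i j k l m n, A i j k l m n = A l m n i j k

/-- The orthogonal group `O(3)`. -/
abbrev O3 : Type := Matrix.orthogonalGroup (Fin 3) ℝ

namespace Moduli

variable (𝓜 : Moduli)

/-- The symmetry group of the fourth-order tensor. -/
def symC : Set O3 := {Q | ∀ i j k l,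
  ∑ o, ∑ p, ∑ q, ∑ r, Q.1 i o * Q.1 j p * Q.1 k q * Q.1 l r * 𝓜.C o p q r = 𝓜.C i j k l}

/-- The symmetry group of the fifth-order tensor. -/
def symM : Set O3 := {Q | ∀ i j k l m,
  ∑ o, ∑ p, ∑ q, ∑ r, ∑ s,
    Q.1 i o * Q.1 j p * Q.1 k q * Q.1 l r * Q.1 m s * 𝓜.M o p q r s = 𝓜.M i j k l m}

/-- The symmetry group of the sixth-order tensor. -/
def symA : Set O3 := {Q | ∀ i j k l m n,
  ∑ o, ∑ p, ∑ q, ∑ r, ∑ s, ∑ t,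
    Q.1 i o * Q.1 j p * Q.1 k q * Q.1 l r * Q.1 m s * Q.1 n t * 𝓜.A o p q r s t
      = 𝓜.A i j k l m n}

/-- The symmetry group of the material. -/
def symL : Set O3 := 𝓜.symA ∩ 𝓜.symM ∩ 𝓜.symC

end Moduli

/-- The rotation by `π/2` about the `x₃`-axis. -/
def rotQuarter : O3 :=
  ⟨!![0, -1, 0; 1, 0, 0; 0, 0, 1], by
    rw [Matrix.mem_orthogonalGroup_iff]
    ext i j
    fin_cases i <;> fin_cases j <;> simp [Matrix.mul_apply, Fin.sum_univ_three]⟩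

/-- The rotation by `π` about the `x₁`-axis. -/
def rotHalf : O3 :=
  ⟨!![1, 0, 0; 0, -1, 0; 0, 0, -1], by
    rw [Matrix.mem_orthogonalGroup_iff]
    ext i j
    fin_cases i <;> fin_cases j <;> simp [Matrix.mul_apply, Fin.sum_univ_three]⟩

/-- The central inversion `-1`. -/
def inversion : O3 :=
  ⟨-1, by rw [Matrix.mem_orthogonalGroup_iff]; simp⟩

/-- The group `ℤ₄ ⊕ ℤ₂ᶜ`, with axis `x₃`. -/
def groupZ4Z2c : Subgroup O3 := Subgroup.closure {rotQuarter, inversion}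

/-- The group `D₄ ⊕ ℤ₂ᶜ` (Hermann–Mauguin symbol `4/mmm`), with axis `x₃`. -/
def groupD4Z2c : Subgroup O3 := Subgroup.closure {rotQuarter, rotHalf, inversion}

/-- The materials of the tetragonal class `ℤ₄ ⊕ ℤ₂ᶜ`: all moduli that are invariant under
`ℤ₄ ⊕ ℤ₂ᶜ`, with `C` in the classical tetragonal form (`4/mmm`, six independent constants). -/
def Moduli.IsTetragonalZ4Z2c (𝓜 : Moduli) : Prop :=
  (groupZ4Z2c : Set O3) ⊆ 𝓜.symL ∧ (groupD4Z2c : Set O3) ⊆ 𝓜.symC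

/-- The linearized strain `e_{lm} = ½ (u_{l,m} + u_{m,l})`. -/
def strain (u : E 3 → E 3) (l m : Fin 3) : E 3 → ℝ := fun x =>
  (1 / 2) * (pd m (fun y => u y l) x + pd l (fun y => u y m) x)

/-- The stress `σ_{ik} = C_{iklm} e_{lm} + M_{iklmn} e_{lm,n}`. -/
def stress (𝓜 : Moduli) (u : E 3 → E 3) (i k : Fin 3) : E 3 → ℝ := fun x =>
  (∑ l, ∑ m, 𝓜.C i k l m * strain u l m x) +
    ∑ l, ∑ m, ∑ n, 𝓜.M i k l m n * pd n (strain u l m) x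

/-- The hyper-stress `τ_{ijk} = M_{lmijk} e_{lm} + A_{ijklmn} e_{lm,n}`. -/
def hyperstress (𝓜 : Moduli) (u : E 3 → E 3) (i j k : Fin 3) : E 3 → ℝ := fun x =>
  (∑ l, ∑ m, 𝓜.M l m i j k * strain u l m x) +
    ∑ l, ∑ m, ∑ n, 𝓜.A i j k l m n * pd n (strain u l m) x

/-- Equilibrium without body forces at the point `x`: `σ_{ik,i} - τ_{ijk,ij} = 0`. -/
def InEquilibriumAt (𝓜 : Moduli) (u : E 3 → E 3) (x : E 3) : Prop :=
  ∀ k, ∑ i, pd i (stress 𝓜 u i k) x - ∑ i, ∑ j, pd j (pd i (hyperstress 𝓜 u i j k)) x = 0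

/-- Equilibrium without body forces at the point `x`, in the form `σ_{ik,i} - τ_{ikj,ij} = 0`, in
which one divergence is taken over the gradient index of the hyper-stress. This is the
Euler–Lagrange equation of the elastic energy. -/
def InVariationalEquilibriumAt (𝓜 : Moduli) (u : E 3 → E 3) (x : E 3) : Prop :=
  ∀ k, ∑ i, pd i (stress 𝓜 u i k) x - ∑ i, ∑ j, pd j (pd i (hyperstress 𝓜 u i k j)) x = 0

/-- `u` is a universal displacement field on `Ω` for the tetragonal class `ℤ₄ ⊕ ℤ₂ᶜ`: it is in
equilibrium without body forces for every material of the class. -/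
def IsUniversal (Ω : Set (E 3)) (u : E 3 → E 3) : Prop :=
  ContDiffOn ℝ 4 u Ω ∧
    ∀ 𝓜 : Moduli, 𝓜.IsTetragonalZ4Z2c → ∀ x ∈ Ω, InEquilibriumAt 𝓜 u x

/-- The same notion for the form of the equilibrium equation derived from the energy. -/
def IsVariationallyUniversal (Ω : Set (E 3)) (u : E 3 → E 3) : Prop :=
  ContDiffOn ℝ 4 u Ω ∧
    ∀ 𝓜 : Moduli, 𝓜.IsTetragonalZ4Z2c → ∀ x ∈ Ω, InVariationalEquilibriumAt 𝓜 u x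

/-- On `Ω`, `u` is the superposition of a homogeneous displacement field `b + F x` and of the
classical tetragonal field
`(c₁ x₂ x₃ + c₂ x₁ x₃, -c₂ x₂ x₃ + c₃ x₁ x₃, g (x₁, x₂))` with `g` harmonic and satisfying `P`. -/
def IsTetragonalField (P : (E 2 → ℝ) → Prop) (Ω : Set (E 3)) (u : E 3 → E 3) : Prop :=
  ∃ (b : E 3) (F : Matrix (Fin 3) (Fin 3) ℝ) (c₁ c₂ c₃ : ℝ) (g : E 2 → ℝ),
    InnerProductSpace.HarmonicOnNhd g Set.univ ∧ P g ∧
    ∀ x ∈ Ω, ∀ i, u x i = b i + ∑ j, F i j * x j +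
      ![c₁ * x 1 * x 2 + c₂ * x 0 * x 2,
        -c₂ * x 1 * x 2 + c₃ * x 0 * x 2,
        g !₂[x 0, x 1]] i

/-- The fourth-order constraints on `g`. -/
def FourthOrderConstraints (g : E 2 → ℝ) : Prop :=
  ContDiff ℝ 4 g ∧ ∀ x,
    pd 0 (pd 0 (pd 1 (pd 1 g))) x = 0 ∧
    pd 0 (pd 0 (pd 0 (pd 0 g))) x + pd 1 (pd 1 (pd 1 (pd 1 g))) x = 0 ∧
    pd 0 (pd 0 (pd 0 (pd 1 g))) x = 0 ∧
    pd 0 (pd 1 (pd 1 (pd 1 g))) x = 0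

/-- `g (x₁, x₂) = f₁ (x₁) + x₂ f₂ (x₁) + f₃ (x₂) + x₁ f₄ (x₂)` with `f₂''' = f₄''' = 0` and
`f₃'''' = -f₁'''' = c` constant. -/
def HasFinalForm (g : E 2 → ℝ) : Prop :=
  ∃ (f₁ f₂ f₃ f₄ : ℝ → ℝ) (c : ℝ),
    ContDiff ℝ 4 f₁ ∧ ContDiff ℝ 4 f₂ ∧ ContDiff ℝ 4 f₃ ∧ ContDiff ℝ 4 f₄ ∧
    (∀ x, g x = f₁ (x 0) + x 1 * f₂ (x 0) + f₃ (x 1) + x 0 * f₄ (x 1)) ∧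
    (∀ t, iteratedDeriv 3 f₂ t = 0) ∧ (∀ t, iteratedDeriv 3 f₄ t = 0) ∧
    (∀ t, iteratedDeriv 4 f₃ t = c) ∧ (∀ t, -iteratedDeriv 4 f₁ t = c)

end StrainGradient

end

/-! The inversion acts on a tensor of odd order by the sign -1, so `M = 0` and only `C` and `A`
matter.

Necessity. The class contains all materials with `A = 0` and classical `C`. Their equilibrium
equations are linear in six free constants, so every coefficient vanishes separately
(`classical_divergence`). On a connected open set this makes the Hessians of u₁ and u₂ constant,
with three parameters, and leaves only h = u₃,₁₁ = -u₃,₂₂ and m = u₃,₁₂ in the Hessian of u₃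
(`exists_hasTetragonalHessian`). The pair (h, -m) satisfies the Cauchy–Riemann equations in (x₁, x₂)
and does not depend locally on x₃, so all second derivatives of h and m are 0, ±p or ±q, with p =
h,₁₁ and q = h,₁₂ (`fourth_pd_axial`). Two purely sixth-order materials, `hyperModuli true` and
`hyperModuli false`, then force p = 0 and q = 0.

Sufficiency. With these Hessians the symmetry of `C` kills the divergence of the stress, and all
fourth derivatives of u vanish, so every second derivative of every hyper-stress component is zero.
Which indices are contracted is then irrelevant, and both forms of equilibrium have the same
universal fields.

Representation. Since h and m are affine, u₃ is affine plus a planar harmonic cubic, a polynomial on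
the whole plane whatever the shape of Ω. Conversely, the constraints annihilate all fourth
derivatives of a harmonic g. Without harmonicity they make the mixed derivative of g affine, and
integrating it gives the form in (c). -/

namespace StrainGradient

/-! ### Calculus of partial derivatives on open sets. -/

section PartialDerivatives

variable {n : ℕ} {Ω : Set (E n)} {f g : E n → ℝ} {x : E n}

theorem contDiffOn_pd {m k : WithTop ℕ∞} (hΩ : IsOpen Ω) (hf : ContDiffOn ℝ k f Ω)
    (hmk : m + 1 ≤ k) (i : Fin n) : ContDiffOn ℝ m (pd i f) Ω :=
  (hf.fderiv_of_isOpen hΩ hmk).clm_apply contDiffOn_const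

theorem pd_congr (hΩ : IsOpen Ω) (h : Set.EqOn f g Ω) (i : Fin n) :
    Set.EqOn (pd i f) (pd i g) Ω := fun x hx => by
  simp only [pd, (h.eventuallyEq_of_mem (hΩ.mem_nhds hx)).fderiv_eq]

theorem pd_pd_apply (hf : ContDiffAt ℝ 2 f x) (i j : Fin n) : pd i (pd j f) x =
    fderiv ℝ (fderiv ℝ f) x (EuclideanSpace.single i 1) (EuclideanSpace.single j 1) := by
  have hd : DifferentiableAt ℝ (fderiv ℝ f) x :=
    (hf.fderiv_right (m := 1) (by norm_num)).differentiableAt (by norm_num)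
  change fderiv ℝ (fun y => fderiv ℝ f y (EuclideanSpace.single j 1)) x _ = _
  rw [fderiv_clm_apply hd (differentiableAt_const _)]
  simp

theorem pd_comm (hΩ : IsOpen Ω) (hf : ContDiffOn ℝ 2 f Ω) (i j : Fin n) :
    Set.EqOn (pd i (pd j f)) (pd j (pd i f)) Ω := fun x hx => by
  have h2 : ContDiffAt ℝ 2 f x := hf.contDiffAt (hΩ.mem_nhds hx)
  rw [pd_pd_apply h2, pd_pd_apply h2]
  exact h2.isSymmSndFDerivAt (by simp) _ _

theorem pd_const (i : Fin n) (c : ℝ) : pd i (fun _ : E n => c) = fun _ => 0 := by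
  ext x; simp [pd]

theorem pd_coord (i j : Fin n) : pd i (fun x : E n => x j) = fun _ => if j = i then 1 else 0 := by
  ext x
  have h : HasFDerivAt (fun x : E n => x j) (EuclideanSpace.proj (𝕜 := ℝ) j : E n →L[ℝ] ℝ) x :=
    (EuclideanSpace.proj (𝕜 := ℝ) j : E n →L[ℝ] ℝ).hasFDerivAt
  simp [pd, h.fderiv]

theorem pd_add_apply (i : Fin n) (hf : DifferentiableAt ℝ f x) (hg : DifferentiableAt ℝ g x) :
    pd i (fun y => f y + g y) x = pd i f x + pd i g x := by
  simp [pd, fderiv_fun_add hf hg]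

theorem pd_sub_apply (i : Fin n) (hf : DifferentiableAt ℝ f x) (hg : DifferentiableAt ℝ g x) :
    pd i (fun y => f y - g y) x = pd i f x - pd i g x := by
  simp [pd, fderiv_fun_sub hf hg]

theorem pd_neg_apply (i : Fin n) : pd i (fun y => -f y) x = -pd i f x := by
  simp [pd, fderiv_fun_neg]

theorem pd_mul_apply (i : Fin n) (hf : DifferentiableAt ℝ f x) (hg : DifferentiableAt ℝ g x) :
    pd i (fun y => f y * g y) x = pd i f x * g x + f x * pd i g x := by
  simp [pd, fderiv_fun_mul hf hg]; ring

theorem pd_const_mul_apply (i : Fin n) (c : ℝ) : pd i (fun y => c * f y) x = c * pd i f x := by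
  simp only [pd]
  change fderiv ℝ (c • f) x _ = _
  rw [fderiv_const_smul_field]; simp

theorem pd_sum_apply {ι : Type*} (s : Finset ι) (i : Fin n) {F : ι → E n → ℝ}
    (hF : ∀ a ∈ s, DifferentiableAt ℝ (F a) x) :
    pd i (fun y => ∑ a ∈ s, F a y) x = ∑ a ∈ s, pd i (F a) x := by
  simp [pd, fderiv_fun_sum hF]

theorem pd_add (i : Fin n) (hf : Differentiable ℝ f) (hg : Differentiable ℝ g) :
    pd i (fun y => f y + g y) = fun x => pd i f x + pd i g x :=
  funext fun x => pd_add_apply i (hf x) (hg x)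

theorem pd_sub (i : Fin n) (hf : Differentiable ℝ f) (hg : Differentiable ℝ g) :
    pd i (fun y => f y - g y) = fun x => pd i f x - pd i g x :=
  funext fun x => pd_sub_apply i (hf x) (hg x)

theorem pd_neg (i : Fin n) : pd i (fun y => -f y) = fun x => -pd i f x :=
  funext fun _ => pd_neg_apply i

theorem pd_mul (i : Fin n) (hf : Differentiable ℝ f) (hg : Differentiable ℝ g) :
    pd i (fun y => f y * g y) = fun x => pd i f x * g x + f x * pd i g x :=
  funext fun x => pd_mul_apply i (hf x) (hg x)

theorem pd_const_mul (i : Fin n) (c : ℝ) : pd i (fun y => c * f y) = fun x => c * pd i f x :=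
  funext fun _ => pd_const_mul_apply i c

/-- A finite linear combination of `C¹` functions is differentiated term by term. -/
theorem pd_sum_const_mul {ι : Type*} [Fintype ι] (hΩ : IsOpen Ω) (c : ι → ℝ) {F : ι → E n → ℝ}
    (hF : ∀ a, ContDiffOn ℝ 1 (F a) Ω) (i : Fin n) :
    Set.EqOn (pd i (fun y => ∑ a, c a * F a y)) (fun y => ∑ a, c a * pd i (F a) y) Ω := by
  intro x hx
  rw [pd_sum_apply]
  · simp only [pd_const_mul_apply]
  · intro a _
    exact (((hF a).differentiableOn (by norm_num)).differentiableAt (hΩ.mem_nhds hx)).const_mul _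

/-- A function with vanishing partial derivatives on a connected open set is constant there. -/
theorem exists_eq_const_of_pd_eq_zero (hΩ : IsOpen Ω) (hc : IsConnected Ω)
    (hf : DifferentiableOn ℝ f Ω) (h : ∀ i, ∀ x ∈ Ω, pd i f x = 0) :
    ∃ c, ∀ x ∈ Ω, f x = c := by
  refine hΩ.exists_is_const_of_fderiv_eq_zero hc.isPreconnected hf fun x hx => ?_
  refine ContinuousLinearMap.coe_injective ((EuclideanSpace.basisFun (Fin n) ℝ).toBasis.ext fun i => ?_)
  simpa [pd] using h i x hx

/-- A function whose gradient is that of `g` differs from `g` by a constant. -/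
theorem exists_eq_add_const_of_pd_eq (hΩ : IsOpen Ω) (hc : IsConnected Ω)
    (hf : DifferentiableOn ℝ f Ω) (hg : DifferentiableOn ℝ g Ω)
    (h : ∀ i, ∀ x ∈ Ω, pd i f x = pd i g x) :
    ∃ c, ∀ x ∈ Ω, f x = g x + c := by
  obtain ⟨c, hc⟩ := exists_eq_const_of_pd_eq_zero (f := fun x => f x - g x) hΩ hc (hf.sub hg)
    fun i x hx => by
      rw [pd_sub_apply i (hf.differentiableAt (hΩ.mem_nhds hx))
        (hg.differentiableAt (hΩ.mem_nhds hx)), h i x hx, sub_self]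
  exact ⟨c, fun x hx => by linarith [hc x hx]⟩

open Laplacian in
/-- The Laplacian as the sum of the pure second partial derivatives. -/
theorem laplacian_eq_sum_pd (hf : ContDiffAt ℝ 2 f x) : Δ f x = ∑ i, pd i (pd i f) x := by
  rw [InnerProductSpace.laplacian_eq_iteratedFDeriv_orthonormalBasis f
    (EuclideanSpace.basisFun (Fin n) ℝ)]
  refine Finset.sum_congr rfl fun i _ => ?_
  rw [pd_pd_apply hf, iteratedFDeriv_two_apply]
  simp

end PartialDerivatives

/-! ### Integration of the fourth-order constraints in the plane. -/

section Plane

theorem pd_comm_of_contDiff {n : ℕ} {f : E n → ℝ} (hf : ContDiff ℝ 2 f) (i j : Fin n) :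
    pd i (pd j f) = pd j (pd i f) :=
  funext fun x => pd_comm isOpen_univ hf.contDiffOn i j (Set.mem_univ x)

theorem contDiff_pd {n : ℕ} {f : E n → ℝ} {m k : WithTop ℕ∞} (hf : ContDiff ℝ k f)
    (hmk : m + 1 ≤ k) (i : Fin n) : ContDiff ℝ m (pd i f) :=
  contDiffOn_univ.1 (contDiffOn_pd isOpen_univ hf.contDiffOn hmk i)

theorem pd_comp_coord {n : ℕ} {φ : ℝ → ℝ} (hφ : Differentiable ℝ φ) (i j : Fin n) :
    pd i (fun x : E n => φ (x j)) = fun x => if j = i then deriv φ (x j) else 0 := by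
  ext x
  have h : HasFDerivAt (fun x : E n => x j) (EuclideanSpace.proj (𝕜 := ℝ) j : E n →L[ℝ] ℝ) x :=
    (EuclideanSpace.proj (𝕜 := ℝ) j : E n →L[ℝ] ℝ).hasFDerivAt
  have h2 := (hφ (x j)).hasDerivAt.comp_hasFDerivAt x h
  have h3 : fderiv ℝ (fun x : E n => φ (x j)) x = _ := h2.fderiv
  simp [pd, h3]

/-- The function `f₁ (x₁) + x₂ f₂ (x₁) + f₃ (x₂) + x₁ f₄ (x₂)` on the plane. -/
def bilinearAxial (f₁ f₂ f₃ f₄ : ℝ → ℝ) : E 2 → ℝ := fun x =>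
  f₁ (x 0) + x 1 * f₂ (x 0) + f₃ (x 1) + x 0 * f₄ (x 1)

variable {f₁ f₂ f₃ f₄ : ℝ → ℝ}

/-- The family `bilinearAxial` is closed under both partial derivatives, so higher ones follow by
rewriting the four entries. -/
theorem pd_zero_bilinearAxial (h₁ : Differentiable ℝ f₁) (h₂ : Differentiable ℝ f₂)
    (h₃ : Differentiable ℝ f₃) (h₄ : Differentiable ℝ f₄) :
    pd 0 (bilinearAxial f₁ f₂ f₃ f₄) = bilinearAxial (deriv f₁) (deriv f₂) f₄ 0 := by
  unfold bilinearAxial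
  simp (disch := fun_prop) [pd_add, pd_mul, pd_comp_coord, pd_coord]

theorem pd_one_bilinearAxial (h₁ : Differentiable ℝ f₁) (h₂ : Differentiable ℝ f₂)
    (h₃ : Differentiable ℝ f₃) (h₄ : Differentiable ℝ f₄) :
    pd 1 (bilinearAxial f₁ f₂ f₃ f₄) = bilinearAxial f₂ 0 (deriv f₃) (deriv f₄) := by
  unfold bilinearAxial
  simp (disch := fun_prop) [pd_add, pd_mul, pd_comp_coord, pd_coord]

theorem fourth_pd_bilinearAxial (h₁ : ContDiff ℝ 4 f₁) (h₂ : ContDiff ℝ 4 f₂)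
    (h₃ : ContDiff ℝ 4 f₃) (h₄ : ContDiff ℝ 4 f₄) (x : E 2) :
    pd 0 (pd 0 (pd 1 (pd 1 (bilinearAxial f₁ f₂ f₃ f₄)))) x = 0 ∧
    pd 0 (pd 0 (pd 0 (pd 0 (bilinearAxial f₁ f₂ f₃ f₄)))) x =
      iteratedDeriv 4 f₁ (x 0) + x 1 * iteratedDeriv 4 f₂ (x 0) ∧
    pd 1 (pd 1 (pd 1 (pd 1 (bilinearAxial f₁ f₂ f₃ f₄)))) x =
      iteratedDeriv 4 f₃ (x 1) + x 0 * iteratedDeriv 4 f₄ (x 1) ∧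
    pd 0 (pd 0 (pd 0 (pd 1 (bilinearAxial f₁ f₂ f₃ f₄)))) x = iteratedDeriv 3 f₂ (x 0) ∧
    pd 0 (pd 1 (pd 1 (pd 1 (bilinearAxial f₁ f₂ f₃ f₄)))) x = iteratedDeriv 3 f₄ (x 1) := by
  have d : ∀ f : ℝ → ℝ, ContDiff ℝ 4 f → Differentiable ℝ f ∧ Differentiable ℝ (deriv f) ∧
      Differentiable ℝ (deriv (deriv f)) ∧ Differentiable ℝ (deriv (deriv (deriv f))) := by
    intro f hf
    have h : ∀ m : ℕ, m < 4 → Differentiable ℝ (iteratedDeriv m f) := fun m hm =>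
      hf.differentiable_iteratedDeriv m (by exact_mod_cast hm)
    refine ⟨by simpa using h 0 (by norm_num), by simpa using h 1 (by norm_num), ?_, ?_⟩
    · simpa [iteratedDeriv_succ] using h 2 (by norm_num)
    · simpa [iteratedDeriv_succ] using h 3 (by norm_num)
  obtain ⟨a₁, b₁, c₁, d₁⟩ := d _ h₁
  obtain ⟨a₂, b₂, c₂, d₂⟩ := d _ h₂
  obtain ⟨a₃, b₃, c₃, d₃⟩ := d _ h₃
  obtain ⟨a₄, b₄, c₄, d₄⟩ := d _ h₄
  have z : Differentiable ℝ (0 : ℝ → ℝ) := differentiable_const 0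
  have dz : deriv (0 : ℝ → ℝ) = 0 := deriv_const' 0
  refine ⟨?_, ?_, ?_, ?_, ?_⟩ <;>
    simp only [pd_zero_bilinearAxial, pd_one_bilinearAxial, dz, z, a₁, a₂, a₃, a₄, b₁, b₂, b₃, b₄,
      c₁, c₂, c₃, c₄, d₁, d₂, d₃, d₄] <;>
    simp [bilinearAxial, iteratedDeriv_succ]

theorem hasDerivAt_comp_fst {v : E 2 → ℝ} (hv : Differentiable ℝ v) (b t : ℝ) :
    HasDerivAt (fun s => v !₂[s, b]) (pd 0 v !₂[t, b]) t := by
  have h : HasDerivAt (fun s : ℝ => !₂[s, b]) (EuclideanSpace.single 0 1 : E 2) t := by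
    have e : (fun s : ℝ => !₂[s, b]) = fun s => s • EuclideanSpace.single 0 1 + !₂[0, b] := by
      ext s i; fin_cases i <;> simp
    rw [e]
    simpa using ((hasDerivAt_id t).smul_const (EuclideanSpace.single 0 1 : E 2)).add_const !₂[0, b]
  exact (hv !₂[t, b]).hasFDerivAt.comp_hasDerivAt t h

theorem hasDerivAt_comp_snd {v : E 2 → ℝ} (hv : Differentiable ℝ v) (a t : ℝ) :
    HasDerivAt (fun s => v !₂[a, s]) (pd 1 v !₂[a, t]) t := by
  have h : HasDerivAt (fun s : ℝ => !₂[a, s]) (EuclideanSpace.single 1 1 : E 2) t := by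
    have e : (fun s : ℝ => !₂[a, s]) = fun s => s • EuclideanSpace.single 1 1 + !₂[a, 0] := by
      ext s i; fin_cases i <;> simp
    rw [e]
    simpa using ((hasDerivAt_id t).smul_const (EuclideanSpace.single 1 1 : E 2)).add_const !₂[a, 0]
  exact (hv !₂[a, t]).hasFDerivAt.comp_hasDerivAt t h

/-- A function on the plane with vanishing mixed second derivative splits as a sum of functions of
one coordinate. -/
theorem eq_add_of_mixed_pd_eq_zero {w : E 2 → ℝ} (hw : ContDiff ℝ 2 w)
    (h : ∀ x, pd 0 (pd 1 w) x = 0) (a b : ℝ) :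
    w !₂[a, b] = w !₂[a, 0] + w !₂[0, b] - w !₂[0, 0] := by
  have hw1 : Differentiable ℝ w := hw.differentiable (by norm_num)
  have hv : Differentiable ℝ (pd 1 w) :=
    (contDiff_pd (m := 1) hw (by norm_num) 1).differentiable (by norm_num)
  -- The derivative along x₂ does not depend on x₁; hence w(a, ·) - w(0, ·) has derivative zero and
  -- is constant.
  have e1 : ∀ s t, pd 1 w !₂[s, t] = pd 1 w !₂[0, t] := fun s t =>
    is_const_of_deriv_eq_zero (fun r => (hasDerivAt_comp_fst hv t r).differentiableAt)
      (fun r => by rw [(hasDerivAt_comp_fst hv t r).deriv, h]) s 0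
  have e2 := is_const_of_deriv_eq_zero
    (fun r => ((hasDerivAt_comp_snd hw1 a r).sub (hasDerivAt_comp_snd hw1 0 r)).differentiableAt)
      (fun r => by
        rw [((hasDerivAt_comp_snd hw1 a r).sub (hasDerivAt_comp_snd hw1 0 r)).deriv, e1, sub_self])
      b 0
  simp only [Pi.sub_apply] at e2
  linarith

theorem HasFinalForm.fourthOrderConstraints {g : E 2 → ℝ} (hg : HasFinalForm g) :
    FourthOrderConstraints g := by
  obtain ⟨f₁, f₂, f₃, f₄, c, h₁, h₂, h₃, h₄, hgf, h2, h4, h3, h1⟩ := hg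
  have e : g = bilinearAxial f₁ f₂ f₃ f₄ := funext hgf
  have z : ∀ f : ℝ → ℝ, (∀ t, iteratedDeriv 3 f t = 0) → ∀ t, iteratedDeriv 4 f t = 0 := by
    intro f hf t
    rw [iteratedDeriv_succ, funext hf]
    simp
  refine ⟨?_, fun x => ?_⟩
  · rw [e]
    unfold bilinearAxial
    fun_prop
  · obtain ⟨p₁, p₂, p₃, p₄, p₅⟩ := fourth_pd_bilinearAxial h₁ h₂ h₃ h₄ x
    rw [e, p₁, p₂, p₃, p₄, p₅, h2, h4, z _ h2, z _ h4, h3]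
    refine ⟨rfl, ?_, rfl, rfl⟩
    linarith [h1 (x 0)]

/-- Three of the constraints say that the Hessian of g,₁₂ vanishes, so g,₁₂ is affine. Subtracting
an explicit antiderivative leaves a function without mixed derivative, which splits; the remaining
constraint then separates variables. -/
theorem FourthOrderConstraints.hasFinalForm {g : E 2 → ℝ} (hg : FourthOrderConstraints g) :
    HasFinalForm g := by
  obtain ⟨hC, hg⟩ := hg
  have hm : ContDiff ℝ 2 (pd 0 (pd 1 g)) :=
    contDiff_pd (m := 2) (k := 3) (contDiff_pd hC (by norm_num) 1) (by norm_num) 0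
  have hg11 : ContDiff ℝ 2 (pd 1 (pd 1 g)) :=
    contDiff_pd (m := 2) (k := 3) (contDiff_pd hC (by norm_num) 1) (by norm_num) 1
  have hg1 : ContDiff ℝ 2 (pd 1 g) := contDiff_pd hC (by norm_num) 1
  have c10 : pd 1 (pd 0 (pd 1 g)) = pd 0 (pd 1 (pd 1 g)) := pd_comm_of_contDiff hg1 1 0
  have m01 : ∀ x, pd 0 (pd 1 (pd 0 (pd 1 g))) x = 0 := fun x => by rw [c10]; exact (hg x).1
  have m11 : ∀ x, pd 1 (pd 1 (pd 0 (pd 1 g))) x = 0 := fun x => by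
    rw [c10, pd_comm_of_contDiff hg11 1 0]; exact (hg x).2.2.2
  have hu : IsConnected (Set.univ : Set (E 2)) := isConnected_univ
  have hd : ∀ i, Differentiable ℝ (pd i (pd 0 (pd 1 g))) := fun i =>
    (contDiff_pd (m := 1) hm (by norm_num) i).differentiable (by norm_num)
  obtain ⟨β, hβ⟩ := exists_eq_const_of_pd_eq_zero isOpen_univ hu (hd 0).differentiableOn
    fun i x _ => by
      fin_cases i
      · exact (hg x).2.2.1
      · change pd 1 (pd 0 _) x = 0
        rw [pd_comm_of_contDiff hm, m01]
  obtain ⟨γ, hγ⟩ := exists_eq_const_of_pd_eq_zero isOpen_univ hu (hd 1).differentiableOn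
    fun i x _ => by
      fin_cases i
      · exact m01 x
      · exact m11 x
  obtain ⟨α, hα⟩ := exists_eq_add_const_of_pd_eq (g := fun x : E 2 => β * x 0 + γ * x 1)
    isOpen_univ hu (hm.differentiable (by norm_num)).differentiableOn
    (by fun_prop) fun i x hx => by
      fin_cases i
      · simp (disch := fun_prop) [pd_add, pd_const_mul, pd_coord, hβ x hx]
      · simp (disch := fun_prop) [pd_add, pd_const_mul, pd_coord, hγ x hx]
  -- The subtracted function x₂(αx₁ + βx₁²/2) + x₁(γx₂²/2) has mixed derivative α + βx₁ + γx₂, that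
  -- of g.
  set w : E 2 → ℝ := fun x =>
    g x - bilinearAxial 0 (fun t => α * t + β / 2 * (t * t)) 0 (fun t => γ / 2 * (t * t)) x with hw
  have hb : ContDiff ℝ 4
      (bilinearAxial 0 (fun t => α * t + β / 2 * (t * t)) 0 (fun t => γ / 2 * (t * t))) := by
    unfold bilinearAxial
    simp only [Pi.zero_apply]
    fun_prop
  have hwC : ContDiff ℝ 4 w := hC.sub hb
  have hw01 : ∀ x, pd 0 (pd 1 w) x = 0 := by
    intro x
    have z : Differentiable ℝ (0 : ℝ → ℝ) := differentiable_const 0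
    have e₂ : deriv (fun t : ℝ => α * t + β / 2 * (t * t)) = fun t => α + β * t := by
      ext t
      simp (disch := fun_prop) [deriv_fun_add, deriv_fun_mul]
      ring
    have e₄ : deriv (fun t : ℝ => γ / 2 * (t * t)) = fun t => γ * t := by
      ext t
      simp (disch := fun_prop) [deriv_fun_mul]
      ring
    have e₀ : deriv (0 : ℝ → ℝ) = 0 := deriv_const' 0
    have hb1 := pd_one_bilinearAxial (f₁ := 0) (f₂ := fun t => α * t + β / 2 * (t * t)) (f₃ := 0)
      (f₄ := fun t => γ / 2 * (t * t)) z (by fun_prop) z (by fun_prop)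
    rw [hw, pd_sub 1 (hC.differentiable (by norm_num)) (hb.differentiable (by norm_num)),
      pd_sub_apply 0 (hg1.differentiable (by norm_num) x)
        ((contDiff_pd (m := 1) hb (by norm_num) 1).differentiable (by norm_num) x),
      hα x trivial, hb1, e₄, e₀, pd_zero_bilinearAxial (by fun_prop) z z (by fun_prop), e₂]
    simp [bilinearAxial]
    ring
  have hsplit := eq_add_of_mixed_pd_eq_zero (hwC.of_le (by norm_num)) hw01
  have hf₁ : ContDiff ℝ 4 (fun t => w !₂[t, 0]) := by
    refine hwC.comp (contDiff_euclidean.2 fun i => ?_)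
    fin_cases i <;> simp <;> fun_prop
  have hf₃ : ContDiff ℝ 4 (fun t => w !₂[0, t] - w !₂[0, 0]) := by
    refine ContDiff.sub (hwC.comp (contDiff_euclidean.2 fun i => ?_)) contDiff_const
    fin_cases i <;> simp <;> fun_prop
  have hf₂ : ContDiff ℝ 4 (fun t : ℝ => α * t + β / 2 * (t * t)) := by fun_prop
  have hf₄ : ContDiff ℝ 4 (fun t : ℝ => γ / 2 * (t * t)) := by fun_prop
  have hx : ∀ x : E 2, x = !₂[x 0, x 1] := fun x => by ext i; fin_cases i <;> simp
  have hgf : ∀ x, g x = bilinearAxial (fun t => w !₂[t, 0]) (fun t => α * t + β / 2 * (t * t))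
      (fun t => w !₂[0, t] - w !₂[0, 0]) (fun t => γ / 2 * (t * t)) x := by
    intro x
    have h := hsplit (x 0) (x 1)
    rw [← hx] at h
    have h' : w x = g x - bilinearAxial 0 (fun t => α * t + β / 2 * (t * t)) 0
      (fun t => γ / 2 * (t * t)) x := rfl
    simp only [bilinearAxial, Pi.zero_apply] at h' ⊢
    linarith
  -- Read off from the constraint on g,₁₁₁₂ instead of differentiating the polynomial.
  have h23 : ∀ t, iteratedDeriv 3 (fun t : ℝ => α * t + β / 2 * (t * t)) t = 0 := by
    intro t
    have := (fourth_pd_bilinearAxial hf₁ hf₂ hf₃ hf₄ !₂[t, 0]).2.2.2.1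
    rw [← funext hgf, (hg _).2.2.1] at this
    simpa using this.symm
  have h43 : ∀ t, iteratedDeriv 3 (fun t : ℝ => γ / 2 * (t * t)) t = 0 := by
    intro t
    have := (fourth_pd_bilinearAxial hf₁ hf₂ hf₃ hf₄ !₂[0, t]).2.2.2.2
    rw [← funext hgf, (hg _).2.2.2] at this
    simpa using this.symm
  have z : ∀ f : ℝ → ℝ, (∀ t, iteratedDeriv 3 f t = 0) → ∀ t, iteratedDeriv 4 f t = 0 := by
    intro f hf t
    rw [iteratedDeriv_succ, funext hf]
    simp
  -- Separation of variables: a function of a plus a function of b is zero, so both are constant and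
  -- opposite.
  have key : ∀ a b, iteratedDeriv 4 (fun t => w !₂[t, 0]) a +
      iteratedDeriv 4 (fun t => w !₂[0, t] - w !₂[0, 0]) b = 0 := by
    intro a b
    have h := fourth_pd_bilinearAxial hf₁ hf₂ hf₃ hf₄ !₂[a, b]
    have h' := (hg !₂[a, b]).2.1
    rw [← funext hgf, z _ h23, z _ h43] at h
    rw [h.2.1, h.2.2.1] at h'
    simpa using h'
  refine ⟨_, _, _, _, iteratedDeriv 4 (fun t => w !₂[0, t] - w !₂[0, 0]) 0, hf₁, hf₂, hf₃, hf₄,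
    hgf, h23, h43, fun t => ?_, fun t => ?_⟩
  · linarith [key 0 t, key 0 0]
  · linarith [key t 0]

end Plane

/-! ### Signed permutation matrices and the two point groups. -/

section SignedPermutations

/-- `Q` is the signed permutation matrix with entry `s i` at `(i, π i)`. -/
def IsSignedPerm (Q : O3) (π : Equiv.Perm (Fin 3)) (s : Fin 3 → ℝ) : Prop :=
  (∀ i, s i * s i = 1) ∧ ∀ i o, Q.1 i o = if o = π i then s i else 0

variable {Q R : O3} {π ρ : Equiv.Perm (Fin 3)} {s t : Fin 3 → ℝ}

theorem IsSignedPerm.one : IsSignedPerm 1 1 fun _ => 1 :=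
  ⟨fun _ => by norm_num, fun i o => by simp [Matrix.one_apply, eq_comm]⟩

/-- The permutations compose in reverse order because row i of Q selects row π i of R. -/
theorem IsSignedPerm.mul (hQ : IsSignedPerm Q π s) (hR : IsSignedPerm R ρ t) :
    IsSignedPerm (Q * R) (ρ * π) fun i => s i * t (π i) := by
  refine ⟨fun i => ?_, fun i o => ?_⟩
  · linear_combination t (π i) * t (π i) * hQ.1 i + hR.1 (π i)
  · have h : (Q * R).1 i o = ∑ k, Q.1 i k * R.1 k o := Matrix.mul_apply
    rw [h]
    simp only [hQ.2, ite_mul, zero_mul, Finset.sum_ite_eq', Finset.mem_univ, if_true]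
    rw [hR.2, mul_ite, mul_zero]
    rfl

theorem IsSignedPerm.inv (hQ : IsSignedPerm Q π s) :
    IsSignedPerm Q⁻¹ π⁻¹ fun i => s (π⁻¹ i) := by
  refine ⟨fun i => hQ.1 _, fun i o => ?_⟩
  have h : (Q⁻¹).1 i o = Q.1 o i := rfl
  rw [h, hQ.2]
  by_cases h' : i = π o
  · simp [h']
  · rw [if_neg h', if_neg fun h2 => h' (by simp [h2])]

theorem isSignedPerm_rotQuarter :
    IsSignedPerm rotQuarter (Equiv.swap 0 1) ![-1, 1, 1] := by
  refine ⟨fun i => by fin_cases i <;> simp, fun i o => ?_⟩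
  fin_cases i <;> fin_cases o <;> simp [rotQuarter, Equiv.swap_apply_def]

theorem isSignedPerm_rotHalf : IsSignedPerm rotHalf 1 ![1, -1, -1] := by
  refine ⟨fun i => by fin_cases i <;> simp, fun i o => ?_⟩
  fin_cases i <;> fin_cases o <;> simp [rotHalf]

theorem isSignedPerm_inversion : IsSignedPerm inversion 1 fun _ => -1 := by
  refine ⟨fun i => by norm_num, fun i o => ?_⟩
  fin_cases i <;> fin_cases o <;> simp [inversion]

/-- Each row has a single nonzero entry, so the multiple sum collapses to one term and invariance
becomes bookkeeping of signs and indices. -/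
theorem IsSignedPerm.act₄ (hQ : IsSignedPerm Q π s) (T : Fin 3 → Fin 3 → Fin 3 → Fin 3 → ℝ)
    (i j k l : Fin 3) :
    ∑ o, ∑ p, ∑ q, ∑ r, Q.1 i o * Q.1 j p * Q.1 k q * Q.1 l r * T o p q r =
      s i * s j * s k * s l * T (π i) (π j) (π k) (π l) := by
  simp [hQ.2]

theorem IsSignedPerm.act₅ (hQ : IsSignedPerm Q π s)
    (T : Fin 3 → Fin 3 → Fin 3 → Fin 3 → Fin 3 → ℝ) (i j k l m : Fin 3) :
    ∑ o, ∑ p, ∑ q, ∑ r, ∑ v, Q.1 i o * Q.1 j p * Q.1 k q * Q.1 l r * Q.1 m v * T o p q r v =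
      s i * s j * s k * s l * s m * T (π i) (π j) (π k) (π l) (π m) := by
  simp [hQ.2]

theorem IsSignedPerm.act₆ (hQ : IsSignedPerm Q π s)
    (T : Fin 3 → Fin 3 → Fin 3 → Fin 3 → Fin 3 → Fin 3 → ℝ) (i j k l m n : Fin 3) :
    ∑ o, ∑ p, ∑ q, ∑ r, ∑ v, ∑ w,
      Q.1 i o * Q.1 j p * Q.1 k q * Q.1 l r * Q.1 m v * Q.1 n w * T o p q r v w =
      s i * s j * s k * s l * s m * s n * T (π i) (π j) (π k) (π l) (π m) (π n) := by
  simp [hQ.2]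

theorem exists_isSignedPerm_of_mem_groupD4Z2c (h : Q ∈ groupD4Z2c) :
    ∃ π s, IsSignedPerm Q π s ∧ π 2 = 2 := by
  induction h using Subgroup.closure_induction with
  | mem Q hQ =>
    rcases hQ with rfl | rfl | rfl
    · exact ⟨_, _, isSignedPerm_rotQuarter, by decide⟩
    · exact ⟨_, _, isSignedPerm_rotHalf, rfl⟩
    · exact ⟨_, _, isSignedPerm_inversion, rfl⟩
  | one => exact ⟨_, _, IsSignedPerm.one, rfl⟩
  | mul Q R _ _ hQ hR =>
    obtain ⟨π, s, hQ, h1⟩ := hQ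
    obtain ⟨ρ, t, hR, h2⟩ := hR
    exact ⟨_, _, hQ.mul hR, by simp [h1, h2]⟩
  | inv Q _ hQ =>
    obtain ⟨π, s, hQ, h1⟩ := hQ
    exact ⟨_, _, hQ.inv, by rw [Equiv.Perm.inv_eq_iff_eq, h1]⟩

/-- The planar quadratic forms `x₁² - x₂²` and `2 x₁ x₂`, which change sign under `rotQuarter`. -/
def planarForm (b : Bool) : Matrix (Fin 3) (Fin 3) ℝ :=
  if b then !![1, 0, 0; 0, -1, 0; 0, 0, 0] else !![0, 1, 0; 1, 0, 0; 0, 0, 0]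

theorem planarForm_comm (b : Bool) (i j : Fin 3) : planarForm b i j = planarForm b j i := by
  cases b <;> fin_cases i <;> fin_cases j <;> simp [planarForm]

/-- The sign ε is common to both planar forms. This fails for `rotHalf`, which fixes x₁² - x₂² and
reverses 2x₁x₂; it is what admits products of the two forms as moduli of the smaller group. -/
theorem exists_isSignedPerm_of_mem_groupZ4Z2c (h : Q ∈ groupZ4Z2c) :
    ∃ π s, ∃ ε : ℝ, IsSignedPerm Q π s ∧ π 2 = 2 ∧ ε * ε = 1 ∧
      ∀ b i j, s i * s j * planarForm b (π i) (π j) = ε * planarForm b i j := by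
  induction h using Subgroup.closure_induction with
  | mem Q hQ =>
    rcases hQ with rfl | rfl
    · refine ⟨_, _, -1, isSignedPerm_rotQuarter, by decide, by norm_num, fun b i j => ?_⟩
      cases b <;> fin_cases i <;> fin_cases j <;> simp [planarForm, Equiv.swap_apply_def]
    · exact ⟨_, _, 1, isSignedPerm_inversion, rfl, by norm_num, fun b i j => by simp⟩
  | one => exact ⟨_, _, 1, IsSignedPerm.one, rfl, by norm_num, fun b i j => by simp⟩
  | mul Q R _ _ hQ hR =>
    obtain ⟨π, s, ε, hQ, h1, e1, z1⟩ := hQ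
    obtain ⟨ρ, t, δ, hR, h2, e2, z2⟩ := hR
    refine ⟨_, _, ε * δ, hQ.mul hR, by simp [h1, h2], ?_, fun b i j => ?_⟩
    · linear_combination δ * δ * e1 + e2
    · have a := z2 b (π i) (π j)
      have c := z1 b i j
      simp only [Equiv.Perm.mul_apply]
      linear_combination s i * s j * a + δ * c
  | inv Q _ hQ =>
    obtain ⟨π, s, ε, hQ, h1, e1, z1⟩ := hQ
    refine ⟨_, _, ε, hQ.inv, by rw [Equiv.Perm.inv_eq_iff_eq, h1], e1, fun b i j => ?_⟩
    have a := z1 b (π⁻¹ i) (π⁻¹ j)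
    have hπ : ∀ k, π (π⁻¹ k) = k := π.apply_symm_apply
    rw [hπ, hπ] at a
    have h1 := hQ.1 (π⁻¹ i)
    have h2 := hQ.1 (π⁻¹ j)
    set x := s (π⁻¹ i)
    set y := s (π⁻¹ j)
    set p := planarForm b i j
    set q := planarForm b (π⁻¹ i) (π⁻¹ j)
    have : q = ε * (x * y * p) := by rw [a]; linear_combination -q * e1
    rw [this]
    linear_combination ε * p * (y * y) * h1 + ε * p * h2

end SignedPermutations

/-! ### Test materials of the class. -/

section Materials

/-- The fifth-order tensor vanishes for centrosymmetric materials. -/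
theorem Moduli.IsTetragonalZ4Z2c.M_eq_zero {𝓜 : Moduli} (h : 𝓜.IsTetragonalZ4Z2c)
    (i j k l m : Fin 3) : 𝓜.M i j k l m = 0 := by
  have h1 : inversion ∈ 𝓜.symM :=
    (h.1 (Subgroup.subset_closure (by simp) : inversion ∈ groupZ4Z2c)).1.2
  have h2 := h1 i j k l m
  rw [isSignedPerm_inversion.act₅] at h2
  simp at h2
  linarith

/-- The classical tetragonal moduli with six independent constants. -/
def classicalModuli (a b c d e f : ℝ) : Moduli where
  C i j l m := (if i = j ∧ l = m then !![a, b, c; b, a, c; c, c, d] i l else 0) +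
    ((if i = l ∧ j = m then !![0, e, f; e, 0, f; f, f, 0] i j else 0) +
      if i = m ∧ j = l then !![0, e, f; e, 0, f; f, f, 0] i j else 0)
  M _ _ _ _ _ := 0
  A _ _ _ _ _ _ := 0
  C_minor i j l m := by
    fin_cases i <;> fin_cases j <;> fin_cases l <;> fin_cases m <;> simp
  C_major i j l m := by
    fin_cases i <;> fin_cases j <;> fin_cases l <;> fin_cases m <;> simp
  M_left _ _ _ _ _ := rfl
  M_right _ _ _ _ _ := rfl
  A_minor _ _ _ _ _ _ := rfl
  A_major _ _ _ _ _ _ := rfl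

theorem perm_fixing_two (π : Equiv.Perm (Fin 3)) (h : π 2 = 2) :
    π 0 = 0 ∧ π 1 = 1 ∨ π 0 = 1 ∧ π 1 = 0 := by
  revert π; decide

theorem groupZ4Z2c_le_groupD4Z2c : groupZ4Z2c ≤ groupD4Z2c :=
  Subgroup.closure_mono (by rintro Q (rfl | rfl) <;> simp)

/-- The indices of a nonzero entry are equal in pairs, so the signs cancel; the coefficient matrices
are unchanged when the first two axes are exchanged. -/
theorem classicalModuli_isTetragonal (a b c d e f : ℝ) :
    (classicalModuli a b c d e f).IsTetragonalZ4Z2c := by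
  have hC : (groupD4Z2c : Set O3) ⊆ (classicalModuli a b c d e f).symC := by
    intro Q hQ i j k l
    obtain ⟨π, s, h, h2⟩ := exists_isSignedPerm_of_mem_groupD4Z2c hQ
    rw [h.act₄]
    have hN : ∀ i j, !![a, b, c; b, a, c; c, c, d] (π i) (π j) =
        !![a, b, c; b, a, c; c, c, d] i j := by
      rcases perm_fixing_two π h2 with ⟨h0, h1⟩ | ⟨h0, h1⟩ <;> intro i j <;>
        fin_cases i <;> fin_cases j <;> simp [h0, h1, h2]
    have hG : ∀ i j, !![0, e, f; e, 0, f; f, f, 0] (π i) (π j) =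
        !![0, e, f; e, 0, f; f, f, 0] i j := by
      rcases perm_fixing_two π h2 with ⟨h0, h1⟩ | ⟨h0, h1⟩ <;> intro i j <;>
        fin_cases i <;> fin_cases j <;> simp [h0, h1, h2]
    simp only [classicalModuli, hN, hG, π.injective.eq_iff, mul_add]
    refine congrArg₂ _ ?_ (congrArg₂ _ ?_ ?_)
    · split_ifs with h'
      · obtain ⟨rfl, rfl⟩ := h'
        rw [h.1 i, one_mul, h.1 k, one_mul]
      · simp
    · split_ifs with h'
      · obtain ⟨rfl, rfl⟩ := h'
        linear_combination (!![0, e, f; e, 0, f; f, f, 0] i j) * (s j * s j * h.1 i + h.1 j)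
      · simp
    · split_ifs with h'
      · obtain ⟨rfl, rfl⟩ := h'
        linear_combination (!![0, e, f; e, 0, f; f, f, 0] i j) * (s j * s j * h.1 i + h.1 j)
      · simp
  refine ⟨fun Q hQ => ⟨⟨?_, ?_⟩, hC (groupZ4Z2c_le_groupD4Z2c hQ)⟩, hC⟩
  · intro i j k l m n
    simp [classicalModuli]
  · intro i j k l m
    simp [classicalModuli]

/-- The third-order tensor `δ_{i3} z_{jk} + δ_{j3} z_{ik}` of a planar form `z`. -/
def shearTensor (b : Bool) (i j k : Fin 3) : ℝ :=
  (if i = 2 then planarForm b j k else 0) + if j = 2 then planarForm b i k else 0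

/-- The third-order tensor `z_{ij} δ_{k3} + δ_{i3} z_{jk} + δ_{j3} z_{ik}`, with `z` the form
`x₁² - x₂²`. -/
def mixedTensor (i j k : Fin 3) : ℝ :=
  (if k = 2 then planarForm true i j else 0) + shearTensor true i j k

theorem shearTensor_comm (b : Bool) (i j k : Fin 3) :
    shearTensor b i j k = shearTensor b j i k := by
  simp only [shearTensor, add_comm]

theorem mixedTensor_comm (i j k : Fin 3) : mixedTensor i j k = mixedTensor j i k := by
  simp only [mixedTensor, planarForm_comm true i j, shearTensor_comm true i j]

/-- Purely sixth-order moduli: the symmetrized product of `mixedTensor` and `shearTensor b`. -/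
def hyperModuli (b : Bool) : Moduli where
  C _ _ _ _ := 0
  M _ _ _ _ _ := 0
  A i j k l m n := mixedTensor i j k * shearTensor b l m n + shearTensor b i j k * mixedTensor l m n
  C_minor _ _ _ _ := rfl
  C_major _ _ _ _ := rfl
  M_left _ _ _ _ _ := rfl
  M_right _ _ _ _ _ := rfl
  A_minor i j k l m n := by rw [mixedTensor_comm i j, shearTensor_comm b i j]
  A_major i j k l m n := by ring

/-- Each third-order factor carries one axial index and one planar form, hence is multiplied by the
same sign `s 2 * ε`; a product of two factors is invariant. -/
theorem hyperModuli_isTetragonal (b : Bool) : (hyperModuli b).IsTetragonalZ4Z2c := by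
  refine ⟨fun Q hQ => ⟨⟨?_, ?_⟩, ?_⟩, ?_⟩
  · intro i j k l m n
    obtain ⟨π, s, ε, h, h2, e, z⟩ := exists_isSignedPerm_of_mem_groupZ4Z2c hQ
    rw [h.act₆]
    have hδ : ∀ i, π i = 2 ↔ i = 2 := fun i => by rw [← h2, π.injective.eq_iff, h2]
    have hp : ∀ (b : Bool) (p i j : Fin 3),
        s p * s i * s j * (if π p = 2 then planarForm b (π i) (π j) else 0) =
          s 2 * ε * if p = 2 then planarForm b i j else 0 := by
      intro b p i j
      simp only [hδ]
      split_ifs with hp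
      · subst hp
        linear_combination s 2 * z b i j
      · simp
    have hs : ∀ b i j k, s i * s j * s k * shearTensor b (π i) (π j) (π k) =
        s 2 * ε * shearTensor b i j k := by
      intro b i j k
      simp only [shearTensor]
      linear_combination hp b i j k + hp b j i k
    have hm : ∀ i j k, s i * s j * s k * mixedTensor (π i) (π j) (π k) =
        s 2 * ε * mixedTensor i j k := by
      intro i j k
      simp only [mixedTensor]
      linear_combination hp true k i j + hs true i j k
    have hε : (s 2 * ε) * (s 2 * ε) = 1 := by linear_combination ε * ε * h.1 2 + e
    simp only [hyperModuli]
    calc _ = (s i * s j * s k * mixedTensor (π i) (π j) (π k)) *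
          (s l * s m * s n * shearTensor b (π l) (π m) (π n)) +
          (s i * s j * s k * shearTensor b (π i) (π j) (π k)) *
          (s l * s m * s n * mixedTensor (π l) (π m) (π n)) := by ring
      _ = _ := by
        rw [hm, hm, hs, hs]
        linear_combination (mixedTensor i j k * shearTensor b l m n +
          shearTensor b i j k * mixedTensor l m n) * hε
  · intro i j k l m
    simp [hyperModuli]
  · intro i j k l
    simp [hyperModuli]
  · intro Q _ i j k l
    simp [hyperModuli]

end Materials

/-! ### Necessary conditions from the test materials. -/

section Equilibrium

variable {Ω : Set (E 3)} {u : E 3 → E 3} {𝓜 : Moduli}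

theorem contDiffOn_component (hu : ContDiffOn ℝ 4 u Ω) (l : Fin 3) :
    ContDiffOn ℝ 4 (fun y => u y l) Ω := contDiffOn_euclidean.1 hu l

theorem contDiffOn_second_pd {n : ℕ} {Ω : Set (E n)} {f : E n → ℝ} (hΩ : IsOpen Ω)
    (hf : ContDiffOn ℝ 4 f Ω) (i j : Fin n) : ContDiffOn ℝ 2 (pd i (pd j f)) Ω :=
  contDiffOn_pd hΩ (contDiffOn_pd (m := 3) hΩ hf (by norm_num) j) (by norm_num) i

theorem contDiffOn_strain (hΩ : IsOpen Ω) (hu : ContDiffOn ℝ 4 u Ω) (l m : Fin 3) :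
    ContDiffOn ℝ 3 (strain u l m) Ω :=
  contDiffOn_const.mul ((contDiffOn_pd hΩ (contDiffOn_component hu l) (by norm_num) m).add
    (contDiffOn_pd hΩ (contDiffOn_component hu m) (by norm_num) l))

theorem pd_strain (hΩ : IsOpen Ω) (hu : ContDiffOn ℝ 4 u Ω) (n l m : Fin 3) :
    Set.EqOn (pd n (strain u l m)) (fun x => (1 / 2) *
      (pd n (pd m (fun y => u y l)) x + pd n (pd l (fun y => u y m)) x)) Ω := by
  intro x hx
  have h : ∀ l m, DifferentiableAt ℝ (pd m (fun y => u y l)) x := fun l m =>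
    ((contDiffOn_pd (m := 3) hΩ (contDiffOn_component hu l) (by norm_num) m).differentiableOn
      (by norm_num)).differentiableAt (hΩ.mem_nhds hx)
  have e : strain u l m = fun x =>
    (1 / 2) * (pd m (fun y => u y l) x + pd l (fun y => u y m) x) := rfl
  rw [e, pd_const_mul_apply, pd_add_apply n (h l m) (h m l)]

theorem pd_stress (hΩ : IsOpen Ω) (hu : ContDiffOn ℝ 4 u Ω) (hM : ∀ i j k l m, 𝓜.M i j k l m = 0)
    (j i k : Fin 3) : Set.EqOn (pd j (stress 𝓜 u i k))
      (fun x => ∑ l, ∑ m, 𝓜.C i k l m * pd j (strain u l m) x) Ω := by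
  have e : stress 𝓜 u i k =
      fun x => ∑ p : Fin 3 × Fin 3, 𝓜.C i k p.1 p.2 * strain u p.1 p.2 x := by
    ext x
    simp [stress, hM, Fintype.sum_prod_type]
  intro x hx
  rw [e, pd_sum_const_mul hΩ (fun p : Fin 3 × Fin 3 => 𝓜.C i k p.1 p.2)
    (F := fun p => strain u p.1 p.2)
    (fun p => (contDiffOn_strain hΩ hu p.1 p.2).of_le (by norm_num)) j hx]
  simp [Fintype.sum_prod_type]

theorem pd_pd_hyperstress (hΩ : IsOpen Ω) (hu : ContDiffOn ℝ 4 u Ω)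
    (hM : ∀ i j k l m, 𝓜.M i j k l m = 0) (p q i j k : Fin 3) :
    Set.EqOn (pd p (pd q (hyperstress 𝓜 u i j k)))
      (fun x => ∑ l, ∑ m, ∑ n, 𝓜.A i j k l m n * pd p (pd q (pd n (strain u l m))) x) Ω := by
  have e : hyperstress 𝓜 u i j k = fun x => ∑ t : Fin 3 × Fin 3 × Fin 3,
      𝓜.A i j k t.1 t.2.1 t.2.2 * pd t.2.2 (strain u t.1 t.2.1) x := by
    ext x
    simp [hyperstress, hM, Fintype.sum_prod_type]
  have h2 : ∀ t : Fin 3 × Fin 3 × Fin 3, ContDiffOn ℝ 2 (pd t.2.2 (strain u t.1 t.2.1)) Ω :=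
    fun t => contDiffOn_pd hΩ (contDiffOn_strain hΩ hu _ _) (by norm_num) _
  intro x hx
  rw [e, pd_congr hΩ (pd_sum_const_mul hΩ _ (fun t => (h2 t).of_le (by norm_num)) q) p hx,
    pd_sum_const_mul hΩ _ (fun t => contDiffOn_pd hΩ (h2 t) (by norm_num) q) p hx]
  simp [Fintype.sum_prod_type]

/-- The divergence of the stress of a field is zero on `Ω` for every classical tetragonal
material. -/
def IsClassicallyUniversal (Ω : Set (E 3)) (u : E 3 → E 3) : Prop :=
  ∀ a b c d e f : ℝ, ∀ x ∈ Ω, ∀ k, ∑ i, pd i (stress (classicalModuli a b c d e f) u i k) x = 0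

theorem hyperstress_classicalModuli (a b c d e f : ℝ) (i j k : Fin 3) :
    hyperstress (classicalModuli a b c d e f) u i j k = fun _ => 0 := by
  ext x
  simp [hyperstress, classicalModuli]

theorem stress_hyperModuli (b : Bool) (i k : Fin 3) :
    stress (hyperModuli b) u i k = fun _ => 0 := by
  ext x
  simp [stress, hyperModuli]

theorem IsUniversal.isClassicallyUniversal (h : IsUniversal Ω u) : IsClassicallyUniversal Ω u :=
  fun a b c d e f x hx k => by
    simpa [hyperstress_classicalModuli, pd_const] using
      h.2 _ (classicalModuli_isTetragonal a b c d e f) x hx k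

theorem IsVariationallyUniversal.isClassicallyUniversal (h : IsVariationallyUniversal Ω u) :
    IsClassicallyUniversal Ω u :=
  fun a b c d e f x hx k => by
    simpa [hyperstress_classicalModuli, pd_const] using
      h.2 _ (classicalModuli_isTetragonal a b c d e f) x hx k

/-- The Hessian matrices of the components of a universal field. -/
structure HasTetragonalHessian (Ω : Set (E 3)) (u : E 3 → E 3) (c₁ c₂ c₃ : ℝ) : Prop where
  fst : ∀ x ∈ Ω, ∀ i j, pd i (pd j fun y => u y 0) x = !![0, 0, c₂; 0, 0, c₁; c₂, c₁, 0] i j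
  snd : ∀ x ∈ Ω, ∀ i j, pd i (pd j fun y => u y 1) x = !![0, 0, c₃; 0, 0, -c₂; c₃, -c₂, 0] i j
  thd : ∀ x ∈ Ω, ∀ i j, pd i (pd j fun y => u y 2) x =
    !![pd 0 (pd 0 fun y => u y 2) x, pd 0 (pd 1 fun y => u y 2) x, 0;
      pd 0 (pd 1 fun y => u y 2) x, -pd 0 (pd 0 fun y => u y 2) x, 0; 0, 0, 0] i j

/-- The second derivatives of `u₃,₁₁` and `u₃,₁₂` vanish. -/
def HasAxialFourthOrder (Ω : Set (E 3)) (u : E 3 → E 3) : Prop :=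
  ∀ x ∈ Ω, ∀ i j, pd i (pd j (pd 0 (pd 0 fun y => u y 2))) x = 0 ∧
    pd i (pd j (pd 0 (pd 1 fun y => u y 2))) x = 0

theorem classical_divergence (hΩ : IsOpen Ω) (hu : ContDiffOn ℝ 4 u Ω) (a b c d e f : ℝ)
    (x : E 3) (hx : x ∈ Ω) :
    let D := fun i j k => pd i (pd j fun y => u y k) x
    let S := fun k => ∑ i, pd i (stress (classicalModuli a b c d e f) u i k) x
    S 0 = a * D 0 0 0 + b * D 0 1 1 + c * D 0 2 2 + e * (D 1 0 1 + D 1 1 0)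
      + f * (D 2 0 2 + D 2 2 0) ∧
    S 1 = b * D 1 0 0 + a * D 1 1 1 + c * D 1 2 2 + e * (D 0 1 0 + D 0 0 1)
      + f * (D 2 1 2 + D 2 2 1) ∧
    S 2 = c * (D 2 0 0 + D 2 1 1) + d * D 2 2 2
      + f * (D 0 2 0 + D 0 0 2 + D 1 2 1 + D 1 1 2) := by
  intro D S
  have h : ∀ k, S k = ∑ i, ∑ l, ∑ m, (classicalModuli a b c d e f).C i k l m *
      ((1 / 2) * (D i m l + D i l m)) := fun k => by
    refine Finset.sum_congr rfl fun i _ => ?_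
    rw [pd_stress hΩ hu (fun _ _ _ _ _ => rfl) i i k hx]
    refine Finset.sum_congr rfl fun l _ => Finset.sum_congr rfl fun m _ => ?_
    rw [pd_strain hΩ hu i l m hx]
  rw [h, h, h]
  refine ⟨?_, ?_, ?_⟩ <;> simp [Fin.sum_univ_three, classicalModuli] <;> ring

/-- Two constants describe a Hessian that is supported on the entries `(1,3)` and `(2,3)`. -/
theorem exists_const_mixed_pd {f : E 3 → ℝ} (hΩ : IsOpen Ω) (hc : IsConnected Ω)
    (hf : ContDiffOn ℝ 4 f Ω) (h : ∀ i j, i ≠ 2 → j ≠ 2 → ∀ x ∈ Ω, pd i (pd j f) x = 0)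
    (h2 : ∀ x ∈ Ω, pd 2 (pd 2 f) x = 0) (s : Fin 3) (hs : s ≠ 2) :
    ∃ γ, ∀ x ∈ Ω, pd s (pd 2 f) x = γ := by
  have hz : ∀ i g, (∀ x ∈ Ω, g x = 0) → ∀ x ∈ Ω, pd i g x = 0 := fun i g hg x hx => by
    rw [pd_congr hΩ (g := fun _ => 0) hg i hx, pd_const]
  have h1 : ∀ i, ContDiffOn ℝ 2 (pd i f) Ω := fun i => contDiffOn_pd hΩ hf (by norm_num) i
  have hf2 : ContDiffOn ℝ 2 f Ω := hf.of_le (by norm_num)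
  refine exists_eq_const_of_pd_eq_zero hΩ hc
    ((contDiffOn_second_pd hΩ hf s 2).differentiableOn (by norm_num)) fun i x hx => ?_
  by_cases hi : i = 2
  · subst hi
    rw [pd_comm hΩ (h1 2) 2 s hx]
    exact hz s _ h2 x hx
  · rw [pd_congr hΩ (pd_comm hΩ hf2 s 2) i hx, pd_comm hΩ (h1 s) i 2 hx]
    exact hz 2 _ (h i s hi hs) x hx

theorem IsClassicallyUniversal.exists_hasTetragonalHessian (hΩ : IsOpen Ω) (hc : IsConnected Ω)
    (hu : ContDiffOn ℝ 4 u Ω) (h : IsClassicallyUniversal Ω u) :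
    ∃ c₁ c₂ c₃, HasTetragonalHessian Ω u c₁ c₂ c₃ := by
  have key : ∀ x ∈ Ω, ∀ D : Fin 3 → Fin 3 → Fin 3 → ℝ,
      D = (fun i j k => pd i (pd j fun y => u y k) x) →
      (∀ i j k, D i j k = D j i k) ∧
      (D 0 0 0 = 0 ∧ D 0 1 0 = 0 ∧ D 1 1 0 = 0 ∧ D 2 2 0 = 0) ∧
      (D 0 0 1 = 0 ∧ D 0 1 1 = 0 ∧ D 1 1 1 = 0 ∧ D 2 2 1 = 0) ∧
      (D 0 2 2 = 0 ∧ D 1 2 2 = 0 ∧ D 2 2 2 = 0 ∧ D 0 0 2 + D 1 1 2 = 0) ∧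
      D 0 2 0 + D 1 2 1 = 0 := by
    intro x hx D hD
    have hs : ∀ i j k, D i j k = D j i k := fun i j k => by
      rw [hD]
      exact pd_comm hΩ ((contDiffOn_component hu k).of_le (by norm_num)) i j hx
    have E : ∀ a b c d e f : ℝ, _ := fun a b c d e f => by
      have hd := classical_divergence hΩ hu a b c d e f x hx
      simp only [h a b c d e f x hx] at hd
      exact hd
    -- The unit vectors in the space of the six constants isolate the coefficient of each.
    have Ea := E 1 0 0 0 0 0
    have Eb := E 0 1 0 0 0 0
    have Ec := E 0 0 1 0 0 0
    have Ed := E 0 0 0 1 0 0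
    have Ee := E 0 0 0 0 1 0
    have Ef := E 0 0 0 0 0 1
    have hD' : ∀ i j k, pd i (pd j fun y => u y k) x = D i j k := fun i j k => by rw [hD]
    simp only [hD'] at Ea Eb Ec Ed Ee Ef
    have s1 := hs 0 1 0
    have s2 := hs 0 1 1
    have s3 := hs 0 2 2
    have s4 := hs 1 2 2
    have s5 := hs 0 2 0
    have s6 := hs 1 2 1
    refine ⟨hs, ⟨?_, ?_, ?_, ?_⟩, ⟨?_, ?_, ?_, ?_⟩, ⟨?_, ?_, ?_, ?_⟩, ?_⟩ <;> linarith
  have hz : ∀ l, (∀ x ∈ Ω, ∀ D : Fin 3 → Fin 3 → Fin 3 → ℝ,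
      D = (fun i j k => pd i (pd j fun y => u y k) x) →
      D 0 0 l = 0 ∧ D 0 1 l = 0 ∧ D 1 0 l = 0 ∧ D 1 1 l = 0 ∧ D 2 2 l = 0) →
      ∀ s : Fin 3, s ≠ 2 → ∃ γ, ∀ x ∈ Ω, pd s (pd 2 fun y => u y l) x = γ := by
    intro l hl
    refine exists_const_mixed_pd hΩ hc (contDiffOn_component hu l) ?_
      fun x hx => (hl x hx _ rfl).2.2.2.2
    intro i j hi hj x hx
    obtain ⟨h1, h2, h3, h4, -⟩ := hl x hx _ rfl
    fin_cases i <;> fin_cases j <;> first | assumption | simp at hi hj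
  have h0 := hz 0 fun x hx D hD => by
    obtain ⟨hs, ⟨h1, h2, h3, h4⟩, -⟩ := key x hx D hD
    exact ⟨h1, h2, by rw [hs]; exact h2, h3, h4⟩
  have h1 := hz 1 fun x hx D hD => by
    obtain ⟨hs, -, ⟨h1, h2, h3, h4⟩, -⟩ := key x hx D hD
    exact ⟨h1, h2, by rw [hs]; exact h2, h3, h4⟩
  obtain ⟨c₂, hc₂⟩ := h0 0 (by decide)
  obtain ⟨c₁, hc₁⟩ := h0 1 (by decide)
  obtain ⟨c₃, hc₃⟩ := h1 0 (by decide)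
  refine ⟨c₁, c₂, c₃, fun x hx i j => ?_, fun x hx i j => ?_, fun x hx i j => ?_⟩ <;>
    have k0 := key x hx _ rfl <;> have k1 := hc₁ x hx <;> have k2 := hc₂ x hx <;>
    have k3 := hc₃ x hx <;>
    obtain ⟨hs, ⟨a1, a2, a3, a4⟩, ⟨b1, b2, b3, b4⟩, ⟨d1, d2, d3, d4⟩, e⟩ := k0 <;>
    have s01 := fun k => hs 1 0 k <;> have s02 := fun k => hs 2 0 k <;>
    have s12 := fun k => hs 2 1 k <;> dsimp only at * <;>
    fin_cases i <;> fin_cases j <;> simp [*] <;> linarith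

/-- With h = u₃,₁₁ and m = u₃,₁₂, these are the Cauchy–Riemann equations of h - im and the
independence of x₃. They follow from commuting third derivatives. -/
theorem second_pd_axial (hΩ : IsOpen Ω) (hu : ContDiffOn ℝ 4 u Ω) {c₁ c₂ c₃ : ℝ}
    (H : HasTetragonalHessian Ω u c₁ c₂ c₃) :
    (∀ x ∈ Ω, pd 1 (pd 0 (pd 0 fun y => u y 2)) x = pd 0 (pd 0 (pd 1 fun y => u y 2)) x) ∧
    (∀ x ∈ Ω, pd 1 (pd 0 (pd 1 fun y => u y 2)) x = -pd 0 (pd 0 (pd 0 fun y => u y 2)) x) ∧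
    (∀ x ∈ Ω, pd 2 (pd 0 (pd 0 fun y => u y 2)) x = 0) ∧
    (∀ x ∈ Ω, pd 2 (pd 0 (pd 1 fun y => u y 2)) x = 0) := by
  set f := fun y => u y 2 with hf
  have hC : ContDiffOn ℝ 4 f Ω := contDiffOn_component hu 2
  have h1 : ∀ i, ContDiffOn ℝ 2 (pd i f) Ω := fun i => contDiffOn_pd hΩ hC (by norm_num) i
  have hf2 : ContDiffOn ℝ 2 f Ω := hC.of_le (by norm_num)
  have e11 : Set.EqOn (pd 1 (pd 1 f)) (fun x => -pd 0 (pd 0 f) x) Ω := fun x hx => by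
    simpa using H.thd x hx 1 1
  have e2 : ∀ i, Set.EqOn (pd 2 (pd i f)) (fun _ => 0) Ω := fun i x hx => by
    have h := H.thd x hx 2 i
    fin_cases i <;> simpa using h
  refine ⟨fun x hx => ?_, fun x hx => ?_, fun x hx => ?_, fun x hx => ?_⟩
  · rw [pd_comm hΩ (h1 0) 1 0 hx, pd_congr hΩ (pd_comm hΩ hf2 1 0) 0 hx]
  · rw [pd_comm hΩ (h1 1) 1 0 hx, pd_congr hΩ e11 0 hx, pd_neg_apply]
  · rw [pd_comm hΩ (h1 0) 2 0 hx, pd_congr hΩ (e2 0) 0 hx, pd_const]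
  · rw [pd_comm hΩ (h1 1) 2 0 hx, pd_congr hΩ (e2 1) 0 hx, pd_const]

theorem fourth_pd_axial (hΩ : IsOpen Ω) (hu : ContDiffOn ℝ 4 u Ω) {c₁ c₂ c₃ : ℝ}
    (H : HasTetragonalHessian Ω u c₁ c₂ c₃) (x : E 3) (hx : x ∈ Ω) (i j : Fin 3) :
    let p := pd 0 (pd 0 (pd 0 (pd 0 fun y => u y 2))) x
    let q := pd 0 (pd 1 (pd 0 (pd 0 fun y => u y 2))) x
    pd i (pd j (pd 0 (pd 0 fun y => u y 2))) x = !![p, q, 0; q, -p, 0; 0, 0, 0] i j ∧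
    pd i (pd j (pd 0 (pd 1 fun y => u y 2))) x = !![q, -p, 0; -p, -q, 0; 0, 0, 0] i j := by
  obtain ⟨h1, m1, h2, m2⟩ := second_pd_axial hΩ hu H
  have hC := contDiffOn_component hu 2
  have hh := pd_comm hΩ (contDiffOn_second_pd hΩ hC 0 0)
  have hm := pd_comm hΩ (contDiffOn_second_pd hΩ hC 0 1)
  set h := pd 0 (pd 0 fun y => u y 2)
  set m := pd 0 (pd 1 fun y => u y 2)
  intro p q
  have a2 : ∀ i, pd i (pd 2 h) x = 0 := fun i => by
    rw [pd_congr hΩ (g := fun _ => 0) h2 i hx, pd_const]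
  have b2 : ∀ i, pd i (pd 2 m) x = 0 := fun i => by
    rw [pd_congr hΩ (g := fun _ => 0) m2 i hx, pd_const]
  have a1 : ∀ i, pd i (pd 1 h) x = pd i (pd 0 m) x := fun i => pd_congr hΩ h1 i hx
  have b1 : ∀ i, pd i (pd 1 m) x = -pd i (pd 0 h) x := fun i => by
    rw [pd_congr hΩ (g := fun y => -pd 0 h y) m1 i hx, pd_neg_apply]
  have c10 := hh 1 0 hx
  have c20 := hh 2 0 hx
  have c21 := hh 2 1 hx
  have d10 := hm 1 0 hx
  have d20 := hm 2 0 hx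
  have d21 := hm 2 1 hx
  have a10 := a1 0
  have a11 := a1 1
  have b10 := b1 0
  have b11 := b1 1
  have a20 := a2 0
  have a21 := a2 1
  have a22 := a2 2
  have b20 := b2 0
  have b21 := b2 1
  have b22 := b2 2
  fin_cases i <;> fin_cases j <;> refine ⟨?_, ?_⟩ <;> simp [p, q] <;> linarith

/-- Because `A` is a symmetrized product, contracting it with the strain gradient leaves two
scalars, each multiplying one of the third-order tensors. -/
theorem hyperstress_hyperModuli (hΩ : IsOpen Ω) (hu : ContDiffOn ℝ 4 u Ω) {c₁ c₂ c₃ : ℝ}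
    (H : HasTetragonalHessian Ω u c₁ c₂ c₃) (b : Bool) (i j k : Fin 3) :
    Set.EqOn (hyperstress (hyperModuli b) u i j k) (fun x =>
      mixedTensor i j k * (if b then 2 * pd 0 (pd 0 fun y => u y 2) x + 2 * c₂
        else 2 * pd 0 (pd 1 fun y => u y 2) x + c₁ + c₃) +
      shearTensor b i j k * (2 * pd 0 (pd 0 fun y => u y 2) x + 4 * c₂)) Ω := by
  intro x hx
  have hcomp : ∀ l, ∀ i j, pd i (pd j fun y => u y l) x =
    ![!![0, 0, c₂; 0, 0, c₁; c₂, c₁, 0], !![0, 0, c₃; 0, 0, -c₂; c₃, -c₂, 0],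
      !![pd 0 (pd 0 fun y => u y 2) x, pd 0 (pd 1 fun y => u y 2) x, 0;
      pd 0 (pd 1 fun y => u y 2) x, -pd 0 (pd 0 fun y => u y 2) x, 0; 0, 0, 0]] l i j := by
    intro l
    fin_cases l
    · exact H.fst x hx
    · exact H.snd x hx
    · exact H.thd x hx
  generalize pd 0 (pd 0 fun y => u y 2) x = p at hcomp ⊢
  generalize pd 0 (pd 1 fun y => u y 2) x = q at hcomp ⊢
  have e : hyperstress (hyperModuli b) u i j k x =
      mixedTensor i j k * (∑ l, ∑ m, ∑ n, shearTensor b l m n * pd n (strain u l m) x) +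
      shearTensor b i j k * (∑ l, ∑ m, ∑ n, mixedTensor l m n * pd n (strain u l m) x) := by
    simp only [hyperstress, hyperModuli, zero_mul, Finset.sum_const_zero, zero_add, add_mul,
      mul_assoc, Finset.sum_add_distrib, Finset.mul_sum]
  rw [e]
  simp only [pd_strain hΩ hu _ _ _ hx, hcomp]
  cases b
  · congr 2 <;> simp [Fin.sum_univ_three, mixedTensor, shearTensor, planarForm] <;> ring
  · congr 2 <;> simp [Fin.sum_univ_three, mixedTensor, shearTensor, planarForm] <;> ring

theorem pd_pd_hyperstress_hyperModuli (hΩ : IsOpen Ω) (hu : ContDiffOn ℝ 4 u Ω) {c₁ c₂ c₃ : ℝ}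
    (H : HasTetragonalHessian Ω u c₁ c₂ c₃) (b : Bool) (i j k p q : Fin 3) (x : E 3)
    (hx : x ∈ Ω) :
    pd p (pd q (hyperstress (hyperModuli b) u i j k)) x =
      2 * mixedTensor i j k * (if b then pd p (pd q (pd 0 (pd 0 fun y => u y 2))) x
        else pd p (pd q (pd 0 (pd 1 fun y => u y 2))) x) +
      2 * shearTensor b i j k * pd p (pd q (pd 0 (pd 0 fun y => u y 2))) x := by
  have hC := contDiffOn_component hu 2
  have key : ∀ g h : E 3 → ℝ, ContDiffOn ℝ 2 g Ω → ContDiffOn ℝ 2 h Ω → ∀ A B α β : ℝ,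
      pd p (pd q (fun x => A * (2 * g x + α) + B * (2 * h x + β))) x =
        2 * A * pd p (pd q g) x + 2 * B * pd p (pd q h) x := by
    intro g h hg hh A B α β
    have hg' : ∀ i, ContDiffOn ℝ 1 (pd i g) Ω := fun i => contDiffOn_pd hΩ hg (by norm_num) i
    have hh' : ∀ i, ContDiffOn ℝ 1 (pd i h) Ω := fun i => contDiffOn_pd hΩ hh (by norm_num) i
    have hd : ∀ f : E 3 → ℝ, ContDiffOn ℝ 1 f Ω → ∀ y ∈ Ω, DifferentiableAt ℝ f y :=
      fun f hf y hy => (hf.differentiableOn (by norm_num)).differentiableAt (hΩ.mem_nhds hy)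
    have e1 : Set.EqOn (pd q (fun x => A * (2 * g x + α) + B * (2 * h x + β)))
        (fun x => (2 * A) * pd q g x + (2 * B) * pd q h x) Ω := by
      intro y hy
      have dg := hd g (hg.of_le (by norm_num)) y hy
      have dh := hd h (hh.of_le (by norm_num)) y hy
      rw [pd_add_apply q (by fun_prop) (by fun_prop), pd_const_mul_apply, pd_const_mul_apply,
        pd_add_apply q (by fun_prop) (by fun_prop), pd_add_apply q (by fun_prop) (by fun_prop),
        pd_const_mul_apply, pd_const_mul_apply, pd_const, pd_const]
      ring
    have dg := hd _ (hg' q) x hx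
    have dh := hd _ (hh' q) x hx
    rw [pd_congr hΩ e1 p hx, pd_add_apply p (by fun_prop) (by fun_prop), pd_const_mul_apply,
      pd_const_mul_apply]
  rw [pd_congr hΩ (pd_congr hΩ (hyperstress_hyperModuli hΩ hu H b i j k) q) p hx]
  cases b
  -- Reassociation makes `c₁ + c₃` the single additive constant α of `key`.
  · simp only [Bool.false_eq_true, if_false, add_assoc]
    exact key _ _ (contDiffOn_second_pd hΩ hC 0 1) (contDiffOn_second_pd hΩ hC 0 0) _ _ _ _
  · simp only [if_true]
    exact key _ _ (contDiffOn_second_pd hΩ hC 0 0) (contDiffOn_second_pd hΩ hC 0 0) _ _ _ _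

theorem hasAxialFourthOrder_of (hΩ : IsOpen Ω) (hu : ContDiffOn ℝ 4 u Ω) {c₁ c₂ c₃ : ℝ}
    (H : HasTetragonalHessian Ω u c₁ c₂ c₃)
    (h : ∀ x ∈ Ω, pd 0 (pd 0 (pd 0 (pd 0 fun y => u y 2))) x = 0 ∧
      pd 0 (pd 1 (pd 0 (pd 0 fun y => u y 2))) x = 0) : HasAxialFourthOrder Ω u := by
  intro x hx i j
  obtain ⟨h1, h2⟩ := fourth_pd_axial hΩ hu H x hx i j
  rw [h1, h2, (h x hx).1, (h x hx).2]
  fin_cases i <;> fin_cases j <;> simp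

theorem IsUniversal.hasAxialFourthOrder (hΩ : IsOpen Ω) (h : IsUniversal Ω u) {c₁ c₂ c₃ : ℝ}
    (H : HasTetragonalHessian Ω u c₁ c₂ c₃) : HasAxialFourthOrder Ω u := by
  refine hasAxialFourthOrder_of hΩ h.1 H fun x hx => ?_
  have F := fourth_pd_axial hΩ h.1 H x hx
  dsimp only at F
  generalize pd 0 (pd 0 (pd 0 (pd 0 fun y => u y 2))) x = p at F ⊢
  generalize pd 0 (pd 1 (pd 0 (pd 0 fun y => u y 2))) x = q at F ⊢
  -- The axial equation reads 4p = 0 for `true` and 4q = 0 for `false`. Since `shearTensor b i j 2`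
  -- vanishes, only the term z_{ij}δ_{k3} of `mixedTensor` contributes.
  have E : ∀ b, _ := fun b => h.2 _ (hyperModuli_isTetragonal b) x hx 2
  simp only [stress_hyperModuli, pd_const, pd_pd_hyperstress_hyperModuli hΩ h.1 H _ _ _ _ _ _ x hx,
    (F _ _).1, (F _ _).2] at E
  have Et := E true
  have Ef := E false
  simp [Fin.sum_univ_three, mixedTensor, shearTensor, planarForm] at Et Ef
  constructor <;> linarith

theorem IsVariationallyUniversal.hasAxialFourthOrder (hΩ : IsOpen Ω)
    (h : IsVariationallyUniversal Ω u) {c₁ c₂ c₃ : ℝ}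
    (H : HasTetragonalHessian Ω u c₁ c₂ c₃) : HasAxialFourthOrder Ω u := by
  refine hasAxialFourthOrder_of hΩ h.1 H fun x hx => ?_
  have F := fourth_pd_axial hΩ h.1 H x hx
  dsimp only at F
  generalize pd 0 (pd 0 (pd 0 (pd 0 fun y => u y 2))) x = p at F ⊢
  generalize pd 0 (pd 1 (pd 0 (pd 0 fun y => u y 2))) x = q at F ⊢
  -- In this contraction the shear parts of both tensors contribute with equal sign: the axial
  -- equation reads 8p = 0 and 8q = 0.
  have E : ∀ b, _ := fun b => h.2 _ (hyperModuli_isTetragonal b) x hx 2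
  simp only [stress_hyperModuli, pd_const, pd_pd_hyperstress_hyperModuli hΩ h.1 H _ _ _ _ _ _ x hx,
    (F _ _).1, (F _ _).2] at E
  have Et := E true
  have Ef := E false
  simp [Fin.sum_univ_three, mixedTensor, shearTensor, planarForm] at Et Ef
  constructor <;> linarith

end Equilibrium

/-! ### Equilibrium for every material of the class. -/

section Sufficiency

variable {Ω : Set (E 3)} {u : E 3 → E 3} {𝓜 : Moduli} {c₁ c₂ c₃ : ℝ}

/-- A strain gradient e_{lm,i} of such a field can be nonzero only if exactly one of l, m, i is the
axial index. For planar k this meets entries of `C` with a single axial index, which vanish. For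
axial k the surviving moduli multiply the traces u₁,₁₃ + u₂,₂₃ and u₃,₁₁ + u₃,₂₂, both zero. -/
theorem divergence_stress_eq_zero (hΩ : IsOpen Ω) (hu : ContDiffOn ℝ 4 u Ω)
    (H : HasTetragonalHessian Ω u c₁ c₂ c₃) (hm : 𝓜.IsTetragonalZ4Z2c) (x : E 3) (hx : x ∈ Ω)
    (k : Fin 3) : ∑ i, pd i (stress 𝓜 u i k) x = 0 := by
  have mem : ∀ Q ∈ ({rotQuarter, rotHalf, inversion} : Set O3), Q ∈ 𝓜.symC := fun Q hQ =>
    hm.2 (Subgroup.subset_closure hQ)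
  have r1 : ∀ i j k l, _ := fun i j k l =>
    (isSignedPerm_rotQuarter.act₄ 𝓜.C i j k l).symm.trans (mem rotQuarter (by simp) i j k l)
  have r2 : ∀ i j k l, _ := fun i j k l =>
    (isSignedPerm_rotHalf.act₄ 𝓜.C i j k l).symm.trans (mem rotHalf (by simp) i j k l)
  -- Applying the quarter turn twice gives the half turn about x₃. It kills entries with an odd
  -- number of axial indices; `rotHalf` kills those with an odd number of indices 0.
  have r3 : ∀ i j k l, ![-1, -1, 1] i * ![-1, -1, 1] j * ![-1, -1, 1] k * ![-1, -1, 1] l *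
      𝓜.C i j k l = 𝓜.C i j k l := by
    intro i j k l
    have hsw : ∀ i : Fin 3, (![-1, -1, 1] : Fin 3 → ℝ) i =
        ![-1, 1, 1] i * ![-1, 1, 1] (Equiv.swap 0 1 i) := fun i => by
      fin_cases i <;> simp [Equiv.swap_apply_def]
    have h1 := r1 i j k l
    have h2 := r1 (Equiv.swap 0 1 i) (Equiv.swap 0 1 j) (Equiv.swap 0 1 k) (Equiv.swap 0 1 l)
    simp only [Equiv.swap_apply_self] at h2
    rw [← h2] at h1
    rw [hsw, hsw, hsw, hsw]
    linear_combination h1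
  have z : ∀ i j k l, ![-1, -1, 1] i * ![-1, -1, 1] j * ![-1, -1, 1] k * ![-1, -1, 1] l = (-1 : ℝ) →
      𝓜.C i j k l = 0 := fun i j k l h => by
    have h3 := r3 i j k l
    rw [h] at h3
    linarith
  have z' : ∀ i j k l, ![1, -1, -1] i * ![1, -1, -1] j * ![1, -1, -1] k * ![1, -1, -1] l =
      (-1 : ℝ) → 𝓜.C i j k l = 0 := fun i j k l h => by
    have h3 := r2 i j k l
    rw [h] at h3
    simp only [Equiv.Perm.coe_one, id] at h3
    linarith
  have e1 := r1 2 2 0 0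
  have e2 := r1 0 2 0 2
  have e3 := r1 0 2 2 0
  simp [Equiv.swap_apply_def] at e1 e2 e3
  simp only [pd_stress hΩ hu hm.M_eq_zero _ _ _ hx, pd_strain hΩ hu _ _ _ hx]
  have hcomp : ∀ l, ∀ i j, pd i (pd j fun y => u y l) x =
    ![!![0, 0, c₂; 0, 0, c₁; c₂, c₁, 0], !![0, 0, c₃; 0, 0, -c₂; c₃, -c₂, 0],
      !![pd 0 (pd 0 fun y => u y 2) x, pd 0 (pd 1 fun y => u y 2) x, 0;
      pd 0 (pd 1 fun y => u y 2) x, -pd 0 (pd 0 fun y => u y 2) x, 0; 0, 0, 0]] l i j := by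
    intro l
    fin_cases l
    · exact H.fst x hx
    · exact H.snd x hx
    · exact H.thd x hx
  generalize pd 0 (pd 0 fun y => u y 2) x = p at hcomp
  generalize pd 0 (pd 1 fun y => u y 2) x = q at hcomp
  simp only [hcomp]
  fin_cases k
  · simp [Fin.sum_univ_three, z 2 0 0 0, z 2 0 1 1, z 2 0 0 1, z 2 0 1 0, z 0 0 0 2, z 0 0 2 0,
      z 1 0 0 2, z 1 0 2 0, z 0 0 1 2, z 0 0 2 1, z 1 0 1 2, z 1 0 2 1]
  · simp [Fin.sum_univ_three, z 2 1 0 0, z 2 1 1 1, z 2 1 0 1, z 2 1 1 0, z 0 1 0 2, z 0 1 2 0,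
      z 1 1 0 2, z 1 1 2 0, z 0 1 1 2, z 0 1 2 1, z 1 1 1 2, z 1 1 2 1]
  · simp [Fin.sum_univ_three, z' 2 2 0 1, z' 2 2 1 0, z' 1 2 0 2, z' 1 2 2 0, z' 0 2 1 2, z' 0 2 2 1]
    rw [← e1, ← e2, ← e3]
    ring

/-- No summation over i, j, k is involved, so the result serves both forms of the equilibrium
equation. -/
theorem pd_pd_hyperstress_eq_zero (hΩ : IsOpen Ω) (hu : ContDiffOn ℝ 4 u Ω)
    (H : HasTetragonalHessian Ω u c₁ c₂ c₃) (H4 : HasAxialFourthOrder Ω u)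
    (hm : 𝓜.IsTetragonalZ4Z2c) (x : E 3) (hx : x ∈ Ω) (p q i j k : Fin 3) :
    pd p (pd q (hyperstress 𝓜 u i j k)) x = 0 := by
  have zero : ∀ f : E 3 → ℝ, ∀ c, (∀ y ∈ Ω, f y = c) → pd p (pd q f) x = 0 := fun f c hf => by
    rw [pd_congr hΩ (pd_congr hΩ (g := fun _ => c) hf q) p hx, pd_const, pd_const]
  have hD : ∀ l m n, pd p (pd q (pd n (pd m fun y => u y l))) x = 0 := by
    intro l m n
    fin_cases l
    · exact zero _ _ fun y hy => H.fst y hy n m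
    · exact zero _ _ fun y hy => H.snd y hy n m
    · have h := fun y hy => H.thd y hy n m
      have h0 := (H4 x hx p q).1
      have h1 := (H4 x hx p q).2
      have e : ∀ g : E 3 → ℝ, Set.EqOn (pd n (pd m fun y => u y 2)) g Ω →
          pd p (pd q g) x = 0 → pd p (pd q (pd n (pd m fun y => u y 2))) x = 0 := fun g hg h0 => by
        rw [pd_congr hΩ (pd_congr hΩ hg q) p hx, h0]
      have h0' : pd p (pd q (fun y => -pd 0 (pd 0 fun y => u y 2) y)) x = 0 := by
        rw [pd_neg, pd_neg_apply, h0, neg_zero]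
      have hz : pd p (pd q (fun _ : E 3 => (0 : ℝ))) x = 0 := by rw [pd_const, pd_const]
      fin_cases n <;> fin_cases m
      · exact h0
      · exact h1
      · exact e _ h hz
      · exact e _ h h1
      · exact e _ h h0'
      · exact e _ h hz
      · exact e _ h hz
      · exact e _ h hz
      · exact e _ h hz
  have hd : ∀ f : E 3 → ℝ, ContDiffOn ℝ 1 f Ω → ∀ y ∈ Ω, DifferentiableAt ℝ f y :=
    fun f hf y hy => (hf.differentiableOn (by norm_num)).differentiableAt (hΩ.mem_nhds hy)
  have hS : ∀ l m n, pd p (pd q (pd n (strain u l m))) x = 0 := by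
    intro l m n
    have e1 : Set.EqOn (pd q (pd n (strain u l m))) (fun y => (1 / 2) *
        (pd q (pd n (pd m fun y => u y l)) y + pd q (pd n (pd l fun y => u y m)) y)) Ω := by
      intro y hy
      have d1 := hd _ ((contDiffOn_second_pd hΩ (contDiffOn_component hu l) n m).of_le
        (by norm_num)) y hy
      have d2 := hd _ ((contDiffOn_second_pd hΩ (contDiffOn_component hu m) n l).of_le
        (by norm_num)) y hy
      rw [pd_congr hΩ (pd_strain hΩ hu n l m) q hy, pd_const_mul_apply, pd_add_apply q d1 d2]
    have d1 := hd _ (contDiffOn_pd hΩ (contDiffOn_second_pd hΩ (contDiffOn_component hu l) n m)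
        (by norm_num) q) x hx
    have d2 := hd _ (contDiffOn_pd hΩ (contDiffOn_second_pd hΩ (contDiffOn_component hu m) n l)
        (by norm_num) q) x hx
    rw [pd_congr hΩ e1 p hx, pd_const_mul_apply, pd_add_apply p d1 d2, hD, hD]
    simp
  rw [pd_pd_hyperstress hΩ hu hm.M_eq_zero p q i j k hx]
  simp [hS]

theorem isUniversal_iff (hΩ : IsOpen Ω) (hc : IsConnected Ω) :
    IsUniversal Ω u ↔ ContDiffOn ℝ 4 u Ω ∧
      (∃ c₁ c₂ c₃, HasTetragonalHessian Ω u c₁ c₂ c₃) ∧ HasAxialFourthOrder Ω u := by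
  constructor
  · intro h
    obtain ⟨c₁, c₂, c₃, H⟩ := h.isClassicallyUniversal.exists_hasTetragonalHessian hΩ hc h.1
    exact ⟨h.1, ⟨c₁, c₂, c₃, H⟩, h.hasAxialFourthOrder hΩ H⟩
  · rintro ⟨hu, ⟨c₁, c₂, c₃, H⟩, H4⟩
    refine ⟨hu, fun 𝓜 hm x hx k => ?_⟩
    simp [divergence_stress_eq_zero hΩ hu H hm x hx, pd_pd_hyperstress_eq_zero hΩ hu H H4 hm x hx]

theorem isVariationallyUniversal_iff (hΩ : IsOpen Ω) (hc : IsConnected Ω) :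
    IsVariationallyUniversal Ω u ↔ ContDiffOn ℝ 4 u Ω ∧
      (∃ c₁ c₂ c₃, HasTetragonalHessian Ω u c₁ c₂ c₃) ∧ HasAxialFourthOrder Ω u := by
  constructor
  · intro h
    obtain ⟨c₁, c₂, c₃, H⟩ := h.isClassicallyUniversal.exists_hasTetragonalHessian hΩ hc h.1
    exact ⟨h.1, ⟨c₁, c₂, c₃, H⟩, h.hasAxialFourthOrder hΩ H⟩
  · rintro ⟨hu, ⟨c₁, c₂, c₃, H⟩, H4⟩
    refine ⟨hu, fun 𝓜 hm x hx k => ?_⟩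
    simp [divergence_stress_eq_zero hΩ hu H hm x hx, pd_pd_hyperstress_eq_zero hΩ hu H H4 hm x hx]

end Sufficiency

/-! ### From Hessians to explicit displacement fields. -/

section Representation

/-- Two functions with the same Hessian on a connected open set differ by an affine function. -/
theorem exists_eq_add_affine_of_hessian_eq {n : ℕ} {Ω : Set (E n)} {f g : E n → ℝ}
    (hΩ : IsOpen Ω) (hc : IsConnected Ω) (hf : ContDiffOn ℝ 2 f Ω) (hg : ContDiffOn ℝ 2 g Ω)
    (h : ∀ x ∈ Ω, ∀ i j, pd i (pd j f) x = pd i (pd j g) x) :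
    ∃ (b : ℝ) (F : Fin n → ℝ), ∀ x ∈ Ω, f x = b + ∑ j, F j * x j + g x := by
  have hd : ∀ f : E n → ℝ, ContDiffOn ℝ 2 f Ω → ∀ j, DifferentiableOn ℝ (pd j f) Ω :=
    fun f hf j => (contDiffOn_pd (m := 1) hΩ hf (by norm_num) j).differentiableOn (by norm_num)
  choose F hF using fun j => exists_eq_add_const_of_pd_eq hΩ hc (hd f hf j) (hd g hg j)
    fun i x hx => h x hx i j
  have hg' : DifferentiableOn ℝ g Ω := hg.differentiableOn (by norm_num)
  obtain ⟨b, hb⟩ := exists_eq_add_const_of_pd_eq (g := fun x => g x + ∑ j, F j * x j) hΩ hc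
    (hf.differentiableOn (by norm_num)) (hg'.add (by fun_prop)) fun i x hx => by
      have hgx : DifferentiableAt ℝ g x := hg'.differentiableAt (hΩ.mem_nhds hx)
      rw [pd_add_apply i hgx (by fun_prop), pd_sum_apply _ _ (fun j _ => by fun_prop), hF i x hx]
      simp [pd_const_mul_apply, pd_coord]
  exact ⟨b, F, fun x hx => by rw [hb x hx]; ring⟩

theorem pd_pd_affine_add {n : ℕ} (b : ℝ) (F : Fin n → ℝ) {G : E n → ℝ} (hG : ContDiff ℝ 2 G)
    (i j : Fin n) : pd i (pd j fun x => b + ∑ k, F k * x k + G x) = pd i (pd j G) := by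
  have hG0 : Differentiable ℝ G := hG.differentiable (by norm_num)
  have hG1 : Differentiable ℝ (pd j G) :=
    (contDiff_pd (m := 1) hG (by norm_num) j).differentiable (by norm_num)
  have e : pd j (fun x => b + ∑ k, F k * x k + G x) = fun x => F j + pd j G x := by
    ext x
    rw [pd_add_apply j (by fun_prop) (hG0 x), pd_add_apply j (by fun_prop) (by fun_prop),
      pd_sum_apply _ _ (fun k _ => by fun_prop)]
    simp [pd_const_mul_apply, pd_coord, pd_const]
  rw [e, pd_add i (by fun_prop) hG1, pd_const]
  simp

theorem hessian_axial_bilinear (a b : ℝ) (x : E 3) (i j : Fin 3) :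
    pd i (pd j fun x => a * x 1 * x 2 + b * x 0 * x 2) x =
      !![0, 0, b; 0, 0, a; b, a, 0] i j := by
  fin_cases i <;> fin_cases j <;>
    simp (disch := fun_prop) [pd_add, pd_mul, pd_const, pd_coord]

/-- This is the chain rule for the linear projection of space onto the plane. -/
theorem pd_comp_plane {g : E 2 → ℝ} (hg : Differentiable ℝ g) :
    pd 0 (fun x : E 3 => g !₂[x 0, x 1]) = (fun x : E 3 => pd 0 g !₂[x 0, x 1]) ∧
    pd 1 (fun x : E 3 => g !₂[x 0, x 1]) = (fun x : E 3 => pd 1 g !₂[x 0, x 1]) ∧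
    pd 2 (fun x : E 3 => g !₂[x 0, x 1]) = fun _ => 0 := by
  set L : E 3 →L[ℝ] E 2 :=
    (EuclideanSpace.proj (𝕜 := ℝ) (0 : Fin 3) : E 3 →L[ℝ] ℝ).smulRight
      (EuclideanSpace.single 0 1 : E 2) +
    (EuclideanSpace.proj (𝕜 := ℝ) (1 : Fin 3) : E 3 →L[ℝ] ℝ).smulRight
      (EuclideanSpace.single 1 1 : E 2) with hL
  have e : ∀ x : E 3, !₂[x 0, x 1] = L x := fun x => by
    ext i
    fin_cases i <;> simp [hL]
  have key : ∀ i x, pd i (fun x : E 3 => g !₂[x 0, x 1]) x =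
      fderiv ℝ g !₂[x 0, x 1] (L (EuclideanSpace.single i 1)) := by
    intro i x
    simp only [e, pd]
    have h := ((hg (L x)).hasFDerivAt.comp x L.hasFDerivAt).fderiv
    exact congrArg (fun T : E 3 →L[ℝ] ℝ => T (EuclideanSpace.single i 1)) h
  refine ⟨funext fun x => ?_, funext fun x => ?_, funext fun x => ?_⟩ <;> rw [key] <;>
    simp [hL, pd]

theorem contDiff_comp_plane {g : E 2 → ℝ} {k : WithTop ℕ∞} (hg : ContDiff ℝ k g) :
    ContDiff ℝ k (fun x : E 3 => g !₂[x 0, x 1]) := by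
  refine hg.comp (contDiff_euclidean.2 fun i => ?_)
  fin_cases i <;> simp <;> fun_prop

/-- The harmonic polynomials of degree at most three in the plane. -/
noncomputable def harmonicCubic (c l₀ l₁ α β γ δ : ℝ) : E 2 → ℝ := fun y =>
  c + l₀ * y 0 + l₁ * y 1 + α / 2 * (y 0 * y 0 - y 1 * y 1) + β * (y 0 * y 1) +
    γ / 6 * (y 0 * y 0 * y 0 - 3 * (y 0 * y 1 * y 1)) +
    δ / 6 * (3 * (y 0 * y 0 * y 1) - y 1 * y 1 * y 1)

theorem contDiff_harmonicCubic (c l₀ l₁ α β γ δ : ℝ) (k : WithTop ℕ∞) :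
    ContDiff ℝ k (harmonicCubic c l₀ l₁ α β γ δ) := by
  unfold harmonicCubic
  fun_prop

theorem pd_zero_harmonicCubic (c l₀ l₁ α β γ δ : ℝ) :
    pd 0 (harmonicCubic c l₀ l₁ α β γ δ) = harmonicCubic l₀ α β γ δ 0 0 := by
  unfold harmonicCubic
  ext y
  simp (disch := fun_prop) [pd_add, pd_sub, pd_mul, pd_const, pd_coord]
  ring

theorem pd_one_harmonicCubic (c l₀ l₁ α β γ δ : ℝ) :
    pd 1 (harmonicCubic c l₀ l₁ α β γ δ) = harmonicCubic l₁ β (-α) δ (-γ) 0 0 := by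
  unfold harmonicCubic
  ext y
  simp (disch := fun_prop) [pd_add, pd_sub, pd_mul, pd_const, pd_coord]
  ring

theorem harmonicOnNhd_univ_iff {g : E 2 → ℝ} (hg : ContDiff ℝ 2 g) :
    InnerProductSpace.HarmonicOnNhd g Set.univ ↔
      ∀ x, pd 0 (pd 0 g) x + pd 1 (pd 1 g) x = 0 := by
  have e := fun x => laplacian_eq_sum_pd (hg.contDiffAt (x := x))
  simp only [Fin.sum_univ_two] at e
  constructor
  · intro h x
    rw [← e]
    exact (h x trivial).2.self_of_nhds
  · intro h x _
    exact ⟨hg.contDiffAt, Filter.Eventually.of_forall fun y => (e y).trans (h y)⟩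

theorem harmonicCubic_harmonic (c l₀ l₁ α β γ δ : ℝ) :
    InnerProductSpace.HarmonicOnNhd (harmonicCubic c l₀ l₁ α β γ δ) Set.univ := by
  rw [harmonicOnNhd_univ_iff (contDiff_harmonicCubic _ _ _ _ _ _ _ _)]
  intro x
  simp only [pd_zero_harmonicCubic, pd_one_harmonicCubic]
  simp [harmonicCubic]
  ring

theorem harmonicCubic_fourthOrderConstraints (c l₀ l₁ α β γ δ : ℝ) :
    FourthOrderConstraints (harmonicCubic c l₀ l₁ α β γ δ) := by
  refine ⟨contDiff_harmonicCubic _ _ _ _ _ _ _ _, fun x => ?_⟩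
  simp only [pd_zero_harmonicCubic, pd_one_harmonicCubic]
  simp [harmonicCubic]

variable {Ω : Set (E 3)} {u : E 3 → E 3}

/-- All Hessians are at most affine, so explicit polynomials realize them, and connectedness leaves
only an affine difference. The function g is thus given on the whole plane, with no extension from Ω
needed. -/
theorem isTetragonalField_of_hasTetragonalHessian (hΩ : IsOpen Ω) (hc : IsConnected Ω)
    (hu : ContDiffOn ℝ 4 u Ω) {c₁ c₂ c₃ : ℝ} (H : HasTetragonalHessian Ω u c₁ c₂ c₃)
    (H4 : HasAxialFourthOrder Ω u) : IsTetragonalField FourthOrderConstraints Ω u := by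
  obtain ⟨R1, R2, R3, R4⟩ := second_pd_axial hΩ hu H
  have hC : ∀ l, ContDiffOn ℝ 2 (fun y => u y l) Ω := fun l =>
    (contDiffOn_component hu l).of_le (by norm_num)
  have h2 := contDiffOn_second_pd hΩ (contDiffOn_component hu 2)
  have affine : ∀ f : E 3 → ℝ, ContDiffOn ℝ 2 f Ω → (∀ x ∈ Ω, ∀ i j, pd i (pd j f) x = 0) →
      ∃ (b : ℝ) (F : Fin 3 → ℝ), (∀ x ∈ Ω, f x = b + ∑ j, F j * x j) ∧
        ∀ x ∈ Ω, ∀ i, pd i f x = F i := by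
    intro f hf hz
    obtain ⟨b, F, hF⟩ := exists_eq_add_affine_of_hessian_eq (g := fun _ => 0) hΩ hc hf
      contDiffOn_const fun x hx i j => by rw [hz x hx, pd_const, pd_const]
    simp only [add_zero] at hF
    refine ⟨b, F, hF, fun x hx i => ?_⟩
    rw [pd_congr hΩ hF i hx, pd_add_apply _ (by fun_prop) (by fun_prop), pd_const,
      pd_sum_apply _ _ (fun j _ => by fun_prop)]
    simp [pd_const_mul_apply, pd_coord]
  obtain ⟨α, A, hA, hA'⟩ := affine _ (h2 0 0) fun x hx i j => (H4 x hx i j).1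
  obtain ⟨β, B, hB, hB'⟩ := affine _ (h2 0 1) fun x hx i j => (H4 x hx i j).2
  obtain ⟨x₀, hx₀⟩ := hc.nonempty
  -- The Cauchy–Riemann relations link the slopes of u₃,₁₁ and u₃,₁₂, leaving the two cubic
  -- coefficients `A 0` and `A 1`.
  have r1 : A 1 = B 0 := by rw [← hA' x₀ hx₀, ← hB' x₀ hx₀, R1 x₀ hx₀]
  have r2 : B 1 = -A 0 := by rw [← hA' x₀ hx₀, ← hB' x₀ hx₀, R2 x₀ hx₀]
  have r3 : A 2 = 0 := by rw [← hA' x₀ hx₀, R3 x₀ hx₀]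
  have r4 : B 2 = 0 := by rw [← hB' x₀ hx₀, R4 x₀ hx₀]
  have q : ∀ l (v : E 3 → ℝ), ContDiff ℝ 2 v →
      (∀ x ∈ Ω, ∀ i j, pd i (pd j fun y => u y l) x = pd i (pd j v) x) →
      ∃ (b : ℝ) (F : Fin 3 → ℝ), ∀ x ∈ Ω, u x l = b + ∑ j, F j * x j + v x := fun l v hv h =>
    exists_eq_add_affine_of_hessian_eq hΩ hc (hC l) hv.contDiffOn h
  obtain ⟨b₀, F₀, h0⟩ := q 0 (fun x => c₁ * x 1 * x 2 + c₂ * x 0 * x 2) (by fun_prop)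
    fun x hx i j => by
      rw [H.fst x hx, hessian_axial_bilinear]
  obtain ⟨b₁, F₁, h1⟩ := q 1 (fun x => -c₂ * x 1 * x 2 + c₃ * x 0 * x 2) (by fun_prop)
    fun x hx i j => by
      rw [H.snd x hx, hessian_axial_bilinear]
  -- The affine coefficients of the cubic are zero since b + Fx absorbs them.
  obtain ⟨b₂, F₂, h2⟩ := q 2 (fun x => harmonicCubic 0 0 0 α β (A 0) (A 1) !₂[x 0, x 1])
    (contDiff_comp_plane (contDiff_harmonicCubic _ _ _ _ _ _ _ _)) fun x hx i j => by
      have d : ∀ c l₀ l₁ α β γ δ, Differentiable ℝ (harmonicCubic c l₀ l₁ α β γ δ) :=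
        fun c l₀ l₁ α β γ δ => (contDiff_harmonicCubic c l₀ l₁ α β γ δ 1).differentiable
          (by norm_num)
      have d0 := fun c l₀ l₁ α β γ δ => (pd_comp_plane (d c l₀ l₁ α β γ δ)).1
      have d1 := fun c l₀ l₁ α β γ δ => (pd_comp_plane (d c l₀ l₁ α β γ δ)).2.1
      have d2 := fun c l₀ l₁ α β γ δ => (pd_comp_plane (d c l₀ l₁ α β γ δ)).2.2
      rw [H.thd x hx, hA x hx, hB x hx]
      fin_cases i <;> fin_cases j <;>
        simp only [Fin.zero_eta, Fin.mk_one, Fin.reduceFinMk, d0, d1, d2, pd_zero_harmonicCubic,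
          pd_one_harmonicCubic, pd_const] <;>
        simp [harmonicCubic, Fin.sum_univ_three, r1, r2, r3, r4] <;> ring
  refine ⟨!₂[b₀, b₁, b₂], Matrix.of ![F₀, F₁, F₂], c₁, c₂, c₃,
    harmonicCubic 0 0 0 α β (A 0) (A 1), harmonicCubic_harmonic _ _ _ _ _ _ _,
    harmonicCubic_fourthOrderConstraints _ _ _ _ _ _ _, fun x hx i => ?_⟩
  fin_cases i
  · simpa using h0 x hx
  · simpa using h1 x hx
  · simpa using h2 x hx

/-- Only g,₁₁₁₁ is not directly a constraint, and harmonicity turns it into -g,₁₁₂₂ = 0. One index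
is fixed at 0, which covers the second derivatives of g,₁₁ and g,₁₂. -/
theorem FourthOrderConstraints.fourth_pd_eq_zero {g : E 2 → ℝ} (hg : FourthOrderConstraints g)
    (hh : ∀ x, pd 0 (pd 0 g) x + pd 1 (pd 1 g) x = 0) (i j k : Fin 2) :
    pd i (pd j (pd 0 (pd k g))) = fun _ => 0 := by
  obtain ⟨hC, hg⟩ := hg
  have h2 : ∀ i j, ContDiff ℝ 2 (pd i (pd j g)) := fun i j =>
    contDiff_pd (contDiff_pd (m := 3) hC (by norm_num) j) (by norm_num) i
  have h1 : ∀ i, ContDiff ℝ 2 (pd i g) := fun i => contDiff_pd hC (by norm_num) i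
  have e : pd 0 (pd 0 g) = fun x => -pd 1 (pd 1 g) x := funext fun x => by linarith [hh x]
  have z0011 : pd 0 (pd 0 (pd 1 (pd 1 g))) = fun _ => 0 := funext fun x => (hg x).1
  have z0001 : pd 0 (pd 0 (pd 0 (pd 1 g))) = fun _ => 0 := funext fun x => (hg x).2.2.1
  have z0111 : pd 0 (pd 1 (pd 1 (pd 1 g))) = fun _ => 0 := funext fun x => (hg x).2.2.2
  have z0000 : pd 0 (pd 0 (pd 0 (pd 0 g))) = fun _ => 0 := by
    rw [e, pd_neg, pd_neg, z0011]
    simp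
  have c1 : pd 1 (pd 0 g) = pd 0 (pd 1 g) :=
    pd_comm_of_contDiff (hC.of_le (by norm_num)) 1 0
  have c2 : ∀ k, pd 1 (pd 0 (pd k g)) = pd 0 (pd 1 (pd k g)) := fun k =>
    pd_comm_of_contDiff (h1 k) 1 0
  have c3 : ∀ k l, pd 1 (pd 0 (pd k (pd l g))) = pd 0 (pd 1 (pd k (pd l g))) := fun k l =>
    pd_comm_of_contDiff (h2 k l) 1 0
  fin_cases i <;> fin_cases j <;> fin_cases k <;>
    simp [c1, c2, c3, z0011, z0001, z0111, z0000]

theorem IsTetragonalField.hasTetragonalHessian (hΩ : IsOpen Ω)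
    (h : IsTetragonalField FourthOrderConstraints Ω u) :
    ContDiffOn ℝ 4 u Ω ∧ (∃ c₁ c₂ c₃, HasTetragonalHessian Ω u c₁ c₂ c₃) ∧
      HasAxialFourthOrder Ω u := by
  obtain ⟨b, F, c₁, c₂, c₃, g, hh, hg, hux⟩ := h
  rw [harmonicOnNhd_univ_iff (hg.1.of_le (by norm_num))] at hh
  have hz := hg.fourth_pd_eq_zero hh
  have hC := hg.1
  have e0 : Set.EqOn (fun y => u y 0) (fun x => b 0 + ∑ j, F 0 j * x j +
      (c₁ * x 1 * x 2 + c₂ * x 0 * x 2)) Ω := fun x hx => hux x hx 0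
  have e1 : Set.EqOn (fun y => u y 1) (fun x => b 1 + ∑ j, F 1 j * x j +
      (-c₂ * x 1 * x 2 + c₃ * x 0 * x 2)) Ω := fun x hx => hux x hx 1
  have e2 : Set.EqOn (fun y => u y 2) (fun x => b 2 + ∑ j, F 2 j * x j +
      g !₂[x 0, x 1]) Ω := fun x hx => hux x hx 2
  have hG := contDiff_comp_plane hC
  have h1 : ∀ i, ContDiff ℝ 3 (pd i g) := fun i => contDiff_pd hC (by norm_num) i
  have h2 : ∀ i j, ContDiff ℝ 2 (pd i (pd j g)) := fun i j => contDiff_pd (h1 j) (by norm_num) i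
  have h3 : ∀ i j k, ContDiff ℝ 1 (pd i (pd j (pd k g))) := fun i j k =>
    contDiff_pd (h2 j k) (by norm_num) i
  have p0 := pd_comp_plane (hC.differentiable (by norm_num))
  have p1 := fun i => pd_comp_plane ((h1 i).differentiable (by norm_num))
  have p2 := fun i j => pd_comp_plane ((h2 i j).differentiable (by norm_num))
  have p3 := fun i j k => pd_comp_plane ((h3 i j k).differentiable (by norm_num))
  have z : ∀ k i j x, pd i (pd j fun x : E 3 => pd 0 (pd k g) !₂[x 0, x 1]) x = 0 := by
    intro k i j x
    obtain ⟨a0, a1, a2⟩ := p2 0 k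
    have hc : ∀ l, pd i (fun x : E 3 => pd l (pd 0 (pd k g)) !₂[x 0, x 1]) x = 0 := by
      intro l
      obtain ⟨b0, b1, b2⟩ := p3 l 0 k
      rw [hz] at b0 b1
      fin_cases i
      · exact congrFun b0 x
      · exact congrFun b1 x
      · exact congrFun b2 x
    fin_cases j
    · exact (congrArg (fun f => pd i f x) a0).trans (hc 0)
    · exact (congrArg (fun f => pd i f x) a1).trans (hc 1)
    · exact (congrArg (fun f => pd i f x) a2).trans (congrFun (pd_const i 0) x)
  have hD : ∀ x ∈ Ω, ∀ i j, pd i (pd j fun y => u y 2) x =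
      pd i (pd j fun x : E 3 => g !₂[x 0, x 1]) x := by
    intro x hx i j
    rw [pd_congr hΩ (pd_congr hΩ e2 j) i hx, pd_pd_affine_add _ _ (hG.of_le (by norm_num))]
  have c10 : pd 1 (pd 0 g) = pd 0 (pd 1 g) := pd_comm_of_contDiff (hC.of_le (by norm_num)) 1 0
  have c11 : pd 1 (pd 1 g) = fun x => -pd 0 (pd 0 g) x := funext fun x => by linarith [hh x]
  refine ⟨?_, ⟨c₁, c₂, c₃, fun x hx i j => ?_, fun x hx i j => ?_, fun x hx i j => ?_⟩,
    fun x hx i j => ?_⟩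
  · refine contDiffOn_euclidean.2 fun i => ?_
    fin_cases i
    · exact ContDiffOn.congr (by fun_prop) e0
    · exact ContDiffOn.congr (by fun_prop) e1
    · exact ContDiffOn.congr (ContDiffOn.add (by fun_prop) hG.contDiffOn) e2
  · rw [pd_congr hΩ (pd_congr hΩ e0 j) i hx, pd_pd_affine_add _ _ (by fun_prop),
      hessian_axial_bilinear]
  · rw [pd_congr hΩ (pd_congr hΩ e1 j) i hx, pd_pd_affine_add _ _ (by fun_prop),
      hessian_axial_bilinear]
  · simp only [hD x hx]
    fin_cases i <;> fin_cases j <;> simp [p0, p1, pd_const, c10, c11]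
  · have k0 : Set.EqOn (pd 0 (pd 0 fun y => u y 2))
        (fun x : E 3 => pd 0 (pd 0 g) !₂[x 0, x 1]) Ω := fun x hx => by
      rw [hD x hx, p0.1, (p1 0).1]
    have k1 : Set.EqOn (pd 0 (pd 1 fun y => u y 2))
        (fun x : E 3 => pd 0 (pd 1 g) !₂[x 0, x 1]) Ω := fun x hx => by
      rw [hD x hx, p0.2.1, (p1 1).1]
    rw [pd_congr hΩ (pd_congr hΩ k0 j) i hx, pd_congr hΩ (pd_congr hΩ k1 j) i hx]
    exact ⟨z 0 i j x, z 1 i j x⟩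

theorem isTetragonalField_iff (hΩ : IsOpen Ω) (hc : IsConnected Ω) :
    IsTetragonalField FourthOrderConstraints Ω u ↔ ContDiffOn ℝ 4 u Ω ∧
      (∃ c₁ c₂ c₃, HasTetragonalHessian Ω u c₁ c₂ c₃) ∧ HasAxialFourthOrder Ω u :=
  ⟨fun h => h.hasTetragonalHessian hΩ, fun ⟨hu, ⟨_, _, _, H⟩, H4⟩ =>
    isTetragonalField_of_hasTetragonalHessian hΩ hc hu H H4⟩

theorem fourthOrderConstraints_iff (g : E 2 → ℝ) : FourthOrderConstraints g ↔ HasFinalForm g :=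
  ⟨fun h => h.hasFinalForm, fun h => h.fourthOrderConstraints⟩

end Representation

end StrainGradient

theorem mainTheorem8 :
    -- the fifth-order tensor vanishes in this class
    (∀ 𝓜 : StrainGradient.Moduli, 𝓜.IsTetragonalZ4Z2c → ∀ i j k l m, 𝓜.M i j k l m = 0) ∧
    -- the fourth-order constraints on `g` integrate to the final form
    (∀ g : StrainGradient.E 2 → ℝ,
      StrainGradient.FourthOrderConstraints g ↔ StrainGradient.HasFinalForm g) ∧
    -- the universal displacements
    (∀ Ω : Set (StrainGradient.E 3), IsOpen Ω → IsConnected Ω →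
      ∀ u : StrainGradient.E 3 → StrainGradient.E 3,
        (StrainGradient.IsUniversal Ω u ↔
          StrainGradient.IsTetragonalField StrainGradient.FourthOrderConstraints Ω u) ∧
        (StrainGradient.IsUniversal Ω u ↔
          StrainGradient.IsTetragonalField StrainGradient.HasFinalForm Ω u) ∧
        (StrainGradient.IsVariationallyUniversal Ω u ↔
          StrainGradient.IsTetragonalField StrainGradient.HasFinalForm Ω u)) := by
  have e : StrainGradient.FourthOrderConstraints = StrainGradient.HasFinalForm :=
    funext fun g => propext (StrainGradient.fourthOrderConstraints_iff g)
  refine ⟨fun 𝓜 h => h.M_eq_zero, StrainGradient.fourthOrderConstraints_iff,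
    fun Ω hΩ hc u => ?_⟩
  rw [← e, StrainGradient.isUniversal_iff hΩ hc, StrainGradient.isVariationallyUniversal_iff hΩ hc,
    StrainGradient.isTetragonalField_iff hΩ hc]
  exact ⟨Iff.rfl, Iff.rfl, Iff.rfl⟩
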